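/- Let $k$ be a field, let $n\ge 2$, and let $R=k[x_0,\dots,x_n]$ be the standard graded polynomial ring, the homogeneous coordinate ring of $\mathbb P^n=\mathbb P^n_k$. Let $P_0\ne P_1$ be two ($k$-rational) points of $\mathbb P^n$, let $\mathfrak p_i\subset R$ be the homogeneous ideal of $P_i$, and let $a_0\ge a_1\ge 1$ be integers. Let \[ I=\mathfrak p_0^{a_0}\cap\mathfrak p_1^{a_1}\] be the ideal of the two fat points $(P_0,a_0)$ and $(P_1,a_1)$. The module $R/I$ has a minimal graded free resolution $\cdots\to F_1\to F_0\to R/I\to 0$ with every $F_q$ of finite rank; let the graded Betti number $\beta_{q,j}(R/I)$ be the number of summands $R(-j)$ of $F_q$ in a minimal graded free resolution of $R/I$. Then, for any such resolution, for every $q\ge 1$, \[ \beta_{q,q+a_0-1}(R/I)=\binom{a_0+n-2}{a_0+q-1}\binom{a_0+q-2}{q-1}+\sum_{i=1}^{a_0-a_1}\binom{a_0-i+n-2}{a_0-i}\binom{n-1}{q-1},\] \[ \beta_{q,q+a_0+i}(R/I)=\binom{a_1-i+n-3}{a_1-i-1}\binom{n-1}{q-1}\qquad\text{for } i=0,\dots,a_1-1,\]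 $\beta_{0,0}(R/I)=1$, and all other graded Betti numbers of $R/I$ are zero. -/

import Mathlib

open MvPolynomial

namespace FatPoints

/-- The homogeneous ideal of a `k`-rational point `P` of projective space: the ideal of the
standard graded polynomial ring generated by all homogeneous polynomials vanishing at `P`
(for a homogeneous polynomial, vanishing does not depend on the chosen representative). -/
noncomputable def pointIdeal {k : Type*} [Field k] {n : ℕ} (P : Projectivization k (Fin (n + 1) → k)) :
    Ideal (MvPolynomial (Fin (n + 1)) k) :=
  Ideal.span {f | (∃ d : ℕ, f.IsHomogeneous d) ∧ eval P.rep f = 0}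

/-- The ideal `𝔭₀ ^ a₀ ∩ 𝔭₁ ^ a₁` of the fat points `(P₀, a₀)` and `(P₁, a₁)`. -/
noncomputable def twoFatPointsIdeal {k : Type*} [Field k] {n : ℕ}
    (P₀ P₁ : Projectivization k (Fin (n + 1) → k)) (a₀ a₁ : ℕ) :
    Ideal (MvPolynomial (Fin (n + 1)) k) :=
  pointIdeal P₀ ^ a₀ ⊓ pointIdeal P₁ ^ a₁

/-- `f` is homogeneous of degree `t ∈ ℤ` (in particular `f = 0` when `t < 0`). -/
def IsHomogeneousOfDegree {k : Type*} [Field k] {σ : Type*}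
    (f : MvPolynomial σ k) (t : ℤ) : Prop :=
  ∀ m ∈ f.support, (m.degree : ℤ) = t

/-- `f` lies in the degree `t` piece of the graded free module `⨁ b, R(-deg b)`, in which the
basis vector indexed by `b` has degree `deg b`. -/
def InFreeDegree {k : Type*} [Field k] {σ ι : Type*} (deg : ι → ℤ)
    (f : ι → MvPolynomial σ k) (t : ℤ) : Prop :=
  ∀ b, IsHomogeneousOfDegree (f b) (t - deg b)

/-- A minimal graded free resolution
`⋯ → F 2 → F 1 → F 0 → R ⧸ I → 0` over `R = k[x_s : s ∈ σ]`,
where `F i = ⨁ b, R(-deg i b)` has finite rank `rank i`. -/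
structure MinimalGradedFreeResolution {k : Type*} [Field k] {σ : Type*}
    (I : Ideal (MvPolynomial σ k)) where
  /-- the rank of `F i` -/
  rank : ℕ → ℕ
  /-- the degrees of the basis elements of `F i` -/
  deg : (i : ℕ) → Fin (rank i) → ℤ
  /-- the differential `F (i + 1) → F i` -/
  d : (i : ℕ) →
    (Fin (rank (i + 1)) → MvPolynomial σ k) →ₗ[MvPolynomial σ k]
      (Fin (rank i) → MvPolynomial σ k)
  /-- the augmentation `F 0 → R ⧸ I` -/
  aug : (Fin (rank 0) → MvPolynomial σ k) →ₗ[MvPolynomial σ k] (MvPolynomial σ k ⧸ I)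
  /-- the differentials preserve degrees -/
  d_graded : ∀ i t f, InFreeDegree (deg (i + 1)) f t → InFreeDegree (deg i) (d i f) t
  /-- the augmentation preserves degrees -/
  aug_graded : ∀ t f, InFreeDegree (deg 0) f t →
    ∃ g : MvPolynomial σ k, IsHomogeneousOfDegree g t ∧ Ideal.Quotient.mk I g = aug f
  aug_surjective : Function.Surjective aug
  exact_aug : Function.Exact (d 0) aug
  exact_d : ∀ i, Function.Exact (d (i + 1)) (d i)
  /-- minimality: the image of `F (i + 1)` lies in `𝔪 F i`, with `𝔪` generated by the variables -/
  minimal : ∀ i, LinearMap.range (d i) ≤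
    Ideal.span (Set.range (X : σ → MvPolynomial σ k)) •
      (⊤ : Submodule (MvPolynomial σ k) (Fin (rank i) → MvPolynomial σ k))

/-- The graded Betti number `β_{i,j}`: the number of summands `R(-j)` of `F i`. -/
def MinimalGradedFreeResolution.betti {k : Type*} [Field k] {σ : Type*}
    {I : Ideal (MvPolynomial σ k)} (F : MinimalGradedFreeResolution I) (i : ℕ) (j : ℤ) : ℕ :=
  (Finset.univ.filter fun b : Fin (F.rank i) => F.deg i b = j).card

end FatPoints

/-! A linear change of coordinates moves the two points to coordinate points, and the ideal becomes
monomial. Let `S` be the set of the `N = n - 1` variables vanishing at both points, `y` and `z` the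
other two variables, and `c = a₀ - a₁`. The ideal is the sum over `e = 0, …, a₀` of the blocks
`(S)^(a₀ - e) * y^e * z^max(e - c, 0)`.

Listed block by block with `e` increasing, the monomial generators have linear quotients. For a
generator `u` of a block `e ≥ 1`, the colon ideal of the preceding generators by `u` is exactly
`(S)`: multiplying `u` by a variable of `S` lands in block `e - 1`, while any earlier generator has
larger `S`-degree, or the same `S`-degree and a different `S`-part. Block `0`, a power of `(S)`, is
built in the same way, one variable at a time (`HasBetti.insert_variable`).

Adjoining `u` replaces the resolution by its mapping cone with a Koszul complex shifted by `deg u`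
(`HasBetti.sup_span_singleton`). Generators appear in nondecreasing degree, so the comparison maps
have entries in the irrelevant ideal `𝔪`, the cones stay minimal, and Betti numbers add up. A
binomial identity evaluates the contribution of block `0`.

This computes one minimal resolution; `MinimalGradedFreeResolution.betti_unique` carries the result
to all of them. -/

namespace FatPoints

/-! ### Homogeneous polynomials with integer degrees -/

section Homogeneous

variable {k : Type*} [Field k] {σ : Type*}

theorem IsHomogeneousOfDegree.zero (t : ℤ) : IsHomogeneousOfDegree (0 : MvPolynomial σ k) t := by
  simp [IsHomogeneousOfDegree]

theorem IsHomogeneousOfDegree.add {f g : MvPolynomial σ k} {t : ℤ}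
    (hf : IsHomogeneousOfDegree f t) (hg : IsHomogeneousOfDegree g t) :
    IsHomogeneousOfDegree (f + g) t := by
  classical
  intro m hm
  rcases Finset.mem_union.1 (support_add hm) with h | h
  exacts [hf m h, hg m h]

theorem IsHomogeneousOfDegree.neg {f : MvPolynomial σ k} {t : ℤ}
    (hf : IsHomogeneousOfDegree f t) : IsHomogeneousOfDegree (-f) t := by
  intro m hm
  exact hf m (by simpa using hm)

theorem IsHomogeneousOfDegree.sum {ι : Type*} {s : Finset ι} {f : ι → MvPolynomial σ k} {t : ℤ}
    (hf : ∀ i ∈ s, IsHomogeneousOfDegree (f i) t) : IsHomogeneousOfDegree (∑ i ∈ s, f i) t := by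
  classical
  induction s using Finset.induction_on with
  | empty => simpa using IsHomogeneousOfDegree.zero t
  | insert a s ha ih =>
    rw [Finset.sum_insert ha]
    exact (hf a (by simp)).add (ih fun i hi => hf i (by simp [hi]))

theorem IsHomogeneousOfDegree.mul {f g : MvPolynomial σ k} {s t : ℤ}
    (hf : IsHomogeneousOfDegree f s) (hg : IsHomogeneousOfDegree g t) :
    IsHomogeneousOfDegree (f * g) (s + t) := by
  classical
  intro m hm
  obtain ⟨a, ha, b, hb, rfl⟩ := Finset.mem_add.1 (support_mul f g hm)
  rw [← hf a ha, ← hg b hb, map_add]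
  push_cast
  rfl

theorem isHomogeneousOfDegree_C (c : k) : IsHomogeneousOfDegree (C c : MvPolynomial σ k) 0 := by
  classical
  intro m hm
  rw [mem_support_iff, coeff_C] at hm
  have : m = 0 := by by_contra h; exact hm (if_neg (Ne.symm h))
  simp [this]

theorem isHomogeneousOfDegree_one : IsHomogeneousOfDegree (1 : MvPolynomial σ k) 0 := by
  simpa using isHomogeneousOfDegree_C (σ := σ) (1 : k)

theorem isHomogeneousOfDegree_monomial (m : σ →₀ ℕ) (c : k) :
    IsHomogeneousOfDegree (monomial m c) m.degree := by
  classical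
  intro m' hm'
  have := support_monomial_subset hm'
  rw [Finset.mem_singleton] at this
  rw [this]

theorem IsHomogeneousOfDegree.prod {ι : Type*} {s : Finset ι} {f : ι → MvPolynomial σ k}
    {t : ι → ℤ} (hf : ∀ i ∈ s, IsHomogeneousOfDegree (f i) (t i)) :
    IsHomogeneousOfDegree (∏ i ∈ s, f i) (∑ i ∈ s, t i) := by
  classical
  induction s using Finset.induction_on with
  | empty => simpa using isHomogeneousOfDegree_one
  | insert a s ha ih =>
    rw [Finset.prod_insert ha, Finset.sum_insert ha]
    exact (hf a (by simp)).mul (ih fun i hi => hf i (by simp [hi]))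

theorem IsHomogeneousOfDegree.isHomogeneous {f : MvPolynomial σ k} {d : ℕ}
    (hf : IsHomogeneousOfDegree f d) : f.IsHomogeneous d := by
  intro m hm
  have := hf m (mem_support_iff.2 hm)
  rw [show (1 : σ → ℕ) = fun _ => 1 from rfl, ← Finsupp.degree_eq_weight_one]
  exact_mod_cast this

theorem _root_.MvPolynomial.IsHomogeneous.isHomogeneousOfDegree {f : MvPolynomial σ k} {d : ℕ}
    (hf : f.IsHomogeneous d) : IsHomogeneousOfDegree f d := by
  intro m hm
  have := hf (mem_support_iff.1 hm)
  rw [show (1 : σ → ℕ) = fun _ => 1 from rfl, ← Finsupp.degree_eq_weight_one] at this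
  exact_mod_cast this

theorem IsHomogeneousOfDegree.eq_zero_of_neg {f : MvPolynomial σ k} {t : ℤ}
    (hf : IsHomogeneousOfDegree f t) (ht : t < 0) : f = 0 := by
  rw [← support_eq_empty, Finset.eq_empty_iff_forall_notMem]
  intro m hm
  have := hf m hm
  omega

theorem IsHomogeneousOfDegree.constantCoeff_eq_zero {f : MvPolynomial σ k} {t : ℤ}
    (hf : IsHomogeneousOfDegree f t) (ht : t ≠ 0) : constantCoeff f = 0 := by
  by_contra h
  have := hf 0 (mem_support_iff.2 h)
  simp at this
  exact ht this.symm

theorem IsHomogeneousOfDegree.eq_C {f : MvPolynomial σ k}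
    (hf : IsHomogeneousOfDegree f 0) : f = C (constantCoeff f) := by
  classical
  ext m
  rw [coeff_C]
  split_ifs with h
  · rw [← h]; rfl
  · by_contra hm
    have := hf m (mem_support_iff.2 hm)
    norm_cast at this
    exact h ((Finsupp.degree_eq_zero_iff m).1 this).symm

theorem mem_irrelevant_iff {f : MvPolynomial σ k} :
    f ∈ Ideal.span (Set.range (X : σ → MvPolynomial σ k)) ↔ constantCoeff f = 0 := by
  rw [← Set.image_univ, mem_ideal_span_X_image]
  constructor
  · intro h
    by_contra h0
    obtain ⟨i, -, hi⟩ := h 0 (mem_support_iff.2 h0)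
    simp at hi
  · intro h m hm
    by_contra h'
    push Not at h'
    have : m = 0 := by ext i; exact h' i (Set.mem_univ i)
    subst this
    exact (mem_support_iff.1 hm) h

/-- The component of degree `t ∈ ℤ` of a polynomial. -/
noncomputable def intComponent (t : ℤ) : MvPolynomial σ k →ₗ[k] MvPolynomial σ k :=
  if 0 ≤ t then homogeneousComponent t.toNat else 0

theorem coeff_intComponent (t : ℤ) (f : MvPolynomial σ k) (m : σ →₀ ℕ) :
    coeff m (intComponent t f) = if (m.degree : ℤ) = t then coeff m f else 0 := by
  unfold intComponent
  split_ifs with h1 h2 h2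
  · rw [coeff_homogeneousComponent, if_pos (by omega)]
  · rw [coeff_homogeneousComponent, if_neg (by omega)]
  · omega
  · simp

theorem intComponent_isHomogeneousOfDegree (t : ℤ) (f : MvPolynomial σ k) :
    IsHomogeneousOfDegree (intComponent t f) t := by
  intro m hm
  rw [mem_support_iff, coeff_intComponent] at hm
  by_contra h
  exact hm (if_neg h)

theorem IsHomogeneousOfDegree.intComponent_eq {f : MvPolynomial σ k} {t : ℤ}
    (hf : IsHomogeneousOfDegree f t) : intComponent t f = f := by
  ext m
  rw [coeff_intComponent]
  split_ifs with h
  · rfl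
  · by_contra h'
    exact h (hf m (mem_support_iff.2 (Ne.symm h')))

theorem IsHomogeneousOfDegree.intComponent_mul {g : MvPolynomial σ k} {s : ℤ}
    (hg : IsHomogeneousOfDegree g s) (t : ℤ) (f : MvPolynomial σ k) :
    intComponent t (f * g) = intComponent (t - s) f * g := by
  classical
  ext m
  rw [coeff_intComponent, coeff_mul, coeff_mul]
  split_ifs with h
  · refine Finset.sum_congr rfl fun p hp => ?_
    rw [coeff_intComponent]
    split_ifs with h2
    · rfl
    · by_cases hb : coeff p.2 g = 0
      · simp [hb]
      · have := hg _ (mem_support_iff.2 hb)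
        rw [← Finset.HasAntidiagonal.mem_antidiagonal.1 hp, map_add] at h
        push_cast at h
        omega
  · symm
    refine Finset.sum_eq_zero fun p hp => ?_
    rw [coeff_intComponent]
    split_ifs with h2
    · by_cases hb : coeff p.2 g = 0
      · simp [hb]
      · have := hg _ (mem_support_iff.2 hb)
        rw [← Finset.HasAntidiagonal.mem_antidiagonal.1 hp, map_add] at h
        push_cast at h
        omega
    · simp

end Homogeneous

/-! ### Graded maps of free modules -/

section Graded

variable {k : Type*} [Field k] {σ : Type*} {ι κ γ : Type*}

/-- The component of degree `t` of an element of `⨁ b, R(-deg b)`. -/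
noncomputable def freeComponent (deg : ι → ℤ) (t : ℤ) (f : ι → MvPolynomial σ k) :
    ι → MvPolynomial σ k :=
  fun b => intComponent (t - deg b) (f b)

theorem freeComponent_inFreeDegree (deg : ι → ℤ) (t : ℤ) (f : ι → MvPolynomial σ k) :
    InFreeDegree deg (freeComponent deg t f) t :=
  fun _ => intComponent_isHomogeneousOfDegree _ _

theorem freeComponent_sub (deg : ι → ℤ) (t : ℤ) (f g : ι → MvPolynomial σ k) :
    freeComponent deg t (f - g) = freeComponent deg t f - freeComponent deg t g := by
  ext1 b
  simp [freeComponent]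

theorem InFreeDegree.freeComponent_eq {deg : ι → ℤ} {t : ℤ} {f : ι → MvPolynomial σ k}
    (hf : InFreeDegree deg f t) : freeComponent deg t f = f :=
  funext fun b => (hf b).intComponent_eq

theorem inFreeDegree_single [DecidableEq ι] (deg : ι → ℤ) (b : ι) :
    InFreeDegree deg (Pi.single b (1 : MvPolynomial σ k)) (deg b) := by
  intro c
  by_cases h : c = b
  · subst h
    simpa using isHomogeneousOfDegree_one
  · rw [Pi.single_eq_of_ne h]
    exact IsHomogeneousOfDegree.zero _

/-- A linear map of graded free modules that preserves degrees. -/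
def IsGraded (deg : ι → ℤ) (deg' : κ → ℤ)
    (φ : (ι → MvPolynomial σ k) →ₗ[MvPolynomial σ k] (κ → MvPolynomial σ k)) : Prop :=
  ∀ t f, InFreeDegree deg f t → InFreeDegree deg' (φ f) t

theorem IsGraded.comp {deg : ι → ℤ} {deg' : κ → ℤ} {deg'' : γ → ℤ}
    {ψ : (κ → MvPolynomial σ k) →ₗ[MvPolynomial σ k] (γ → MvPolynomial σ k)}
    {φ : (ι → MvPolynomial σ k) →ₗ[MvPolynomial σ k] (κ → MvPolynomial σ k)}
    (hψ : IsGraded deg' deg'' ψ) (hφ : IsGraded deg deg' φ) : IsGraded deg deg'' (ψ ∘ₗ φ) :=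
  fun t f hf => hψ t _ (hφ t f hf)

theorem IsGraded.entry [DecidableEq ι] {deg : ι → ℤ} {deg' : κ → ℤ}
    {φ : (ι → MvPolynomial σ k) →ₗ[MvPolynomial σ k] (κ → MvPolynomial σ k)}
    (hφ : IsGraded deg deg' φ) (b : ι) (c : κ) :
    IsHomogeneousOfDegree (φ (Pi.single b 1) c) (deg b - deg' c) :=
  hφ _ _ (inFreeDegree_single deg b) c

theorem linearMap_apply_eq_sum [Fintype ι] [DecidableEq ι]
    (φ : (ι → MvPolynomial σ k) →ₗ[MvPolynomial σ k] (κ → MvPolynomial σ k))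
    (f : ι → MvPolynomial σ k) (c : κ) :
    φ f c = ∑ b, f b * φ (Pi.single b 1) c := by
  rw [LinearMap.pi_apply_eq_sum_univ φ f, Finset.sum_apply]
  refine Finset.sum_congr rfl fun b _ => ?_
  rw [Pi.smul_apply, smul_eq_mul]
  have : (fun j => if b = j then (1 : MvPolynomial σ k) else 0) = Pi.single b 1 := by
    funext j
    simp [Pi.single_apply, eq_comm]
  rw [this]

theorem isGraded_of_entry [Fintype ι] [DecidableEq ι] {deg : ι → ℤ} {deg' : κ → ℤ}
    {φ : (ι → MvPolynomial σ k) →ₗ[MvPolynomial σ k] (κ → MvPolynomial σ k)}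
    (hφ : ∀ b c, IsHomogeneousOfDegree (φ (Pi.single b 1) c) (deg b - deg' c)) :
    IsGraded deg deg' φ := by
  intro t f hf c
  rw [linearMap_apply_eq_sum]
  refine IsHomogeneousOfDegree.sum fun b _ => ?_
  have := (hf b).mul (hφ b c)
  rwa [sub_add_sub_cancel] at this

theorem IsGraded.map_freeComponent [Fintype ι] {deg : ι → ℤ} {deg' : κ → ℤ}
    {φ : (ι → MvPolynomial σ k) →ₗ[MvPolynomial σ k] (κ → MvPolynomial σ k)}
    (hφ : IsGraded deg deg' φ) (t : ℤ) (f : ι → MvPolynomial σ k) :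
    φ (freeComponent deg t f) = freeComponent deg' t (φ f) := by
  classical
  ext1 c
  rw [linearMap_apply_eq_sum, freeComponent, linearMap_apply_eq_sum, map_sum]
  refine Finset.sum_congr rfl fun b _ => ?_
  rw [(hφ.entry b c).intComponent_mul, sub_sub_sub_cancel_right]
  rfl

/-- Maps out of a graded free module lift along graded maps, modulo a graded submodule. -/
theorem exists_graded_lift [Fintype ι] [Fintype κ] {deg : ι → ℤ} {deg' : κ → ℤ} {deg'' : γ → ℤ}
    {d : (κ → MvPolynomial σ k) →ₗ[MvPolynomial σ k] (γ → MvPolynomial σ k)}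
    (hd : IsGraded deg' deg'' d)
    {ψ : (ι → MvPolynomial σ k) →ₗ[MvPolynomial σ k] (γ → MvPolynomial σ k)}
    (hψ : IsGraded deg deg'' ψ)
    (W : Submodule (MvPolynomial σ k) (γ → MvPolynomial σ k))
    (hW : ∀ t, ∀ w ∈ W, freeComponent deg'' t w ∈ W)
    (h : ∀ f, ∃ g, d g - ψ f ∈ W) :
    ∃ φ : (ι → MvPolynomial σ k) →ₗ[MvPolynomial σ k] (κ → MvPolynomial σ k),
      IsGraded deg deg' φ ∧ ∀ f, d (φ f) - ψ f ∈ W := by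
  classical
  choose g hg using h
  -- Keeping only the component of degree `deg b` of a chosen preimage makes the lift graded; it is
  -- still a preimage modulo `W` because `W` is graded.
  let y : ι → κ → MvPolynomial σ k := fun b => freeComponent deg' (deg b) (g (Pi.single b 1))
  have hsingle : ∀ b, Fintype.linearCombination (MvPolynomial σ k) y (Pi.single b 1) = y b := by
    intro b
    simp
  refine ⟨Fintype.linearCombination (MvPolynomial σ k) y, isGraded_of_entry fun b c => ?_, ?_⟩
  · rw [hsingle]
    exact freeComponent_inFreeDegree _ _ _ c
  · intro f
    have hb : ∀ b, d (y b) - ψ (Pi.single b 1) ∈ W := by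
      intro b
      have h1 := hW (deg b) _ (hg (Pi.single b 1))
      rw [freeComponent_sub, ← hd.map_freeComponent,
        (hψ _ _ (inFreeDegree_single deg b)).freeComponent_eq] at h1
      exact h1
    have h2 : d (Fintype.linearCombination (MvPolynomial σ k) y f) - ψ f
        = ∑ b, f b • (d (y b) - ψ (Pi.single b 1)) := by
      rw [Fintype.linearCombination_apply, map_sum]
      conv_lhs => rw [LinearMap.pi_apply_eq_sum_univ ψ f]
      rw [← Finset.sum_sub_distrib]
      refine Finset.sum_congr rfl fun b _ => ?_
      rw [map_smul, smul_sub]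
      have : (fun j => if b = j then (1 : MvPolynomial σ k) else 0) = Pi.single b 1 := by
        funext j
        simp [Pi.single_apply, eq_comm]
      rw [this]
    rw [h2]
    exact W.sum_mem fun b _ => W.smul_mem _ (hb b)

theorem exists_graded_lift_of_range [Fintype ι] [Fintype κ] {deg : ι → ℤ} {deg' : κ → ℤ}
    {deg'' : γ → ℤ}
    {d : (κ → MvPolynomial σ k) →ₗ[MvPolynomial σ k] (γ → MvPolynomial σ k)}
    (hd : IsGraded deg' deg'' d)
    {ψ : (ι → MvPolynomial σ k) →ₗ[MvPolynomial σ k] (γ → MvPolynomial σ k)}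
    (hψ : IsGraded deg deg'' ψ) (h : ∀ f, ∃ g, d g = ψ f) :
    ∃ φ : (ι → MvPolynomial σ k) →ₗ[MvPolynomial σ k] (κ → MvPolynomial σ k),
      IsGraded deg deg' φ ∧ ∀ f, d (φ f) = ψ f := by
  obtain ⟨φ, h1, h2⟩ := exists_graded_lift hd hψ ⊥
    (by
      intro t w hw
      rw [Submodule.mem_bot] at hw ⊢
      subst hw
      ext1 b
      simp [freeComponent])
    (fun f => by
      obtain ⟨g, hg⟩ := h f
      exact ⟨g, by simp [hg]⟩)
  exact ⟨φ, h1, fun f => by simpa [sub_eq_zero] using h2 f⟩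

/-- `𝔪 F` consists of the vectors with entries in `𝔪`. -/
theorem mem_irrelevant_smul_top [Fintype ι] {f : ι → MvPolynomial σ k} :
    f ∈ Ideal.span (Set.range (X : σ → MvPolynomial σ k)) •
      (⊤ : Submodule (MvPolynomial σ k) (ι → MvPolynomial σ k)) ↔
      ∀ b, constantCoeff (f b) = 0 := by
  classical
  constructor
  · intro h b
    rw [← mem_irrelevant_iff]
    refine Submodule.smul_induction_on h ?_ ?_
    · intro r hr x _
      exact Ideal.mul_mem_right _ _ hr
    · intro x y hx hy
      exact Ideal.add_mem _ hx hy
  · intro h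
    have : f = ∑ b, f b • (Pi.single b 1 : ι → MvPolynomial σ k) := by
      ext1 c
      simp [Finset.sum_apply, Pi.single_apply]
    rw [this]
    exact Submodule.sum_mem _ fun b _ =>
      Submodule.smul_mem_smul (mem_irrelevant_iff.2 (h b)) Submodule.mem_top

end Graded

/-! ### Minimal resolutions and mapping cones -/

section Resolution

variable {k : Type*} [Field k] {σ : Type*}

/-- A minimal graded free resolution of `R ⧸ I` with arbitrary finite index types and the
augmentation lifted to `R`. -/
structure FreeRes (I : Ideal (MvPolynomial σ k)) where
  /-- indices of the basis elements -/
  ι : ℕ → Type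
  /-- finiteness of the ranks -/
  fintype : ∀ i, Fintype (ι i)
  /-- degrees of the basis elements -/
  deg : ∀ i, ι i → ℤ
  /-- the differentials -/
  d : ∀ i, (ι (i + 1) → MvPolynomial σ k) →ₗ[MvPolynomial σ k] (ι i → MvPolynomial σ k)
  /-- the augmentation -/
  aug : (ι 0 → MvPolynomial σ k) →ₗ[MvPolynomial σ k] (Unit → MvPolynomial σ k)
  d_graded : ∀ i, IsGraded (deg (i + 1)) (deg i) (d i)
  aug_graded : IsGraded (deg 0) (fun _ => 0) aug
  aug_surjective : Function.Surjective aug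
  exact_aug : ∀ f, aug f () ∈ I ↔ ∃ g, d 0 g = f
  exact_d : ∀ i f, d i f = 0 ↔ ∃ g, d (i + 1) g = f
  minimal : ∀ i f b, constantCoeff (d i f b) = 0

attribute [instance] FreeRes.fintype

/-- Graded Betti numbers. -/
def FreeRes.betti {I : Ideal (MvPolynomial σ k)} (F : FreeRes I) (q : ℕ) (j : ℤ) : ℕ :=
  (Finset.univ.filter fun b : F.ι q => F.deg q b = j).card

/-- `R ⧸ I` has a minimal graded free resolution with graded Betti numbers `β`. -/
def HasBetti (I : Ideal (MvPolynomial σ k)) (β : ℕ → ℤ → ℕ) : Prop :=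
  ∃ F : FreeRes I, ∀ q j, F.betti q j = β q j

/-- The index types of the resolution of `R` by itself. -/
def unitIndex : ℕ → Type
  | 0 => Unit
  | _ + 1 => Empty

/-- The index types of a mapping cone. -/
def coneIndex (ι κ : ℕ → Type) : ℕ → Type
  | 0 => ι 0
  | q + 1 => ι (q + 1) ⊕ κ q

theorem hasBetti_bot :
    HasBetti (⊥ : Ideal (MvPolynomial σ k)) (fun q j => if q = 0 ∧ j = 0 then 1 else 0) := by
  let fin : ∀ i, Fintype (unitIndex i)
    | 0 => inferInstanceAs (Fintype Unit)
    | _ + 1 => inferInstanceAs (Fintype Empty)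
  have hsub : ∀ i, Subsingleton (unitIndex (i + 1) → MvPolynomial σ k) := fun i =>
    inferInstanceAs (Subsingleton (Empty → MvPolynomial σ k))
  refine ⟨{
    ι := unitIndex
    fintype := fin
    deg := fun _ _ => 0
    d := fun _ => 0
    aug := LinearMap.id
    d_graded := fun _ _ _ _ _ => IsHomogeneousOfDegree.zero _
    aug_graded := fun _ _ hf => hf
    aug_surjective := fun f => ⟨f, rfl⟩
    exact_aug := fun f => ?_
    exact_d := fun i f => ?_
    minimal := fun i f b => by simp }, ?_⟩
  · simp only [Ideal.mem_bot, LinearMap.zero_apply, exists_const]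
    constructor
    · intro h
      exact (funext fun _ => h).symm
    · intro h
      rw [← h]
      rfl
  · have := hsub i
    simp only [LinearMap.zero_apply, exists_const, true_iff]
    exact Subsingleton.elim _ _
  · intro q j
    unfold FreeRes.betti
    rcases q with _ | q
    · by_cases hj : j = 0
      · subst hj
        simp only [Finset.filter_true]
        exact Fintype.card_unit
      · simp [hj, Ne.symm hj]
    · simp only [Nat.add_eq_zero_iff, one_ne_zero, and_false, false_and, if_false]
      rw [Finset.card_eq_zero, Finset.eq_empty_iff_forall_notMem]
      intro b
      exact Empty.elim b

/-- Dependent choice with a relation between consecutive terms, in the form needed to build chain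
maps degree by degree. -/
theorem exists_dependent_seq {A : ℕ → Type*} (P : ∀ q, A q → Prop)
    (Q : ∀ q, A q → A (q + 1) → Prop) (a₀ : A 0) (h₀ : P 0 a₀)
    (hs : ∀ q a, P q a → ∃ b, P (q + 1) b ∧ Q q a b) :
    ∃ f : ∀ q, A q, f 0 = a₀ ∧ ∀ q, P q (f q) ∧ Q q (f q) (f (q + 1)) := by
  choose next hnext using hs
  let f : ∀ q, {a : A q // P q a} := fun q =>
    Nat.rec ⟨a₀, h₀⟩ (fun q a => ⟨next q a.1 a.2, (hnext q a.1 a.2).1⟩) q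
  exact ⟨fun q => (f q).1, rfl, fun q => ⟨(f q).2, (hnext q (f q).1 (f q).2).2⟩⟩

theorem inFreeDegree_add_const {ι : Type*} {deg : ι → ℤ} {D t : ℤ} {f : ι → MvPolynomial σ k} :
    InFreeDegree (fun b => deg b + D) f t ↔ InFreeDegree deg f (t - D) := by
  unfold InFreeDegree
  refine forall_congr' fun b => ?_
  rw [show t - (deg b + D) = t - D - deg b by ring]

theorem IsGraded.add_const {ι κ : Type*} {deg : ι → ℤ} {deg' : κ → ℤ} {D : ℤ}
    {φ : (ι → MvPolynomial σ k) →ₗ[MvPolynomial σ k] (κ → MvPolynomial σ k)}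
    (hφ : IsGraded deg deg' φ) :
    IsGraded (fun b => deg b + D) (fun b => deg' b + D) φ := fun _ _ hf =>
  inFreeDegree_add_const.2 (hφ _ _ (inFreeDegree_add_const.1 hf))

variable {I J : Ideal (MvPolynomial σ k)}

/-- Multiplication by `u : R/J → R/I` lifts to a map of resolutions. -/
theorem FreeRes.exists_chainMap (F : FreeRes I) (K : FreeRes J) {u : MvPolynomial σ k} {D : ℤ}
    (hu : IsHomogeneousOfDegree u D) (hJ : ∀ f ∈ J, u * f ∈ I) :
    ∃ φ : ∀ q, (K.ι q → MvPolynomial σ k) →ₗ[MvPolynomial σ k] (F.ι q → MvPolynomial σ k),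
      (∀ q, IsGraded (fun b => K.deg q b + D) (F.deg q) (φ q)) ∧
      (∀ x, F.aug (φ 0 x) = u • K.aug x) ∧
      ∀ q x, F.d q (φ (q + 1) x) = φ q (K.d q x) := by
  obtain ⟨φ₀, h₀, h₀'⟩ := exists_graded_lift_of_range (ψ := u • K.aug)
    (deg := fun b => K.deg 0 b + D) F.aug_graded
    (fun t f hf c => by
      have := hu.mul (K.aug_graded _ _ (inFreeDegree_add_const.1 hf) c)
      rw [show t - 0 = D + (t - D - 0) by ring]
      exact this)
    (fun f => F.aug_surjective _)
  obtain ⟨φ, h1, h2⟩ := exists_dependent_seq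
    (A := fun q => (K.ι q → MvPolynomial σ k) →ₗ[MvPolynomial σ k] (F.ι q → MvPolynomial σ k))
    -- The invariant records that the next lifting problem is solvable: `φ` sends boundaries of `K`
    -- to boundaries of `F`.
    (fun q φ => IsGraded (fun b => K.deg q b + D) (F.deg q) φ ∧
      ∀ x, ∃ y, F.d q y = φ (K.d q x))
    (fun q φ φ' => ∀ x, F.d q (φ' x) = φ (K.d q x)) φ₀
    ⟨h₀, fun x => by
      rw [← F.exact_aug, h₀']
      exact hJ _ ((K.exact_aug _).2 ⟨x, rfl⟩)⟩
    (by
      rintro q φ ⟨hφ, hφ'⟩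
      obtain ⟨φ', h, h'⟩ := exists_graded_lift_of_range (ψ := φ ∘ₗ K.d q) (F.d_graded q)
        (hφ.comp (K.d_graded q).add_const) hφ'
      refine ⟨φ', ⟨h, fun x => ?_⟩, h'⟩
      rw [← F.exact_d, h', LinearMap.comp_apply, (K.exact_d q _).2 ⟨x, rfl⟩, map_zero])
  refine ⟨φ, fun q => (h2 q).1.1, fun x => ?_, fun q => (h2 q).2⟩
  rw [h1]
  exact h₀' x

theorem InFreeDegree.inl {ι κ : Type*} {a : ι → ℤ} {b : κ → ℤ} {t : ℤ}
    {f : ι ⊕ κ → MvPolynomial σ k} (hf : InFreeDegree (Sum.elim a b) f t) :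
    InFreeDegree a (f ∘ Sum.inl) t := fun i => hf (Sum.inl i)

theorem InFreeDegree.inr {ι κ : Type*} {a : ι → ℤ} {b : κ → ℤ} {t : ℤ}
    {f : ι ⊕ κ → MvPolynomial σ k} (hf : InFreeDegree (Sum.elim a b) f t) :
    InFreeDegree b (f ∘ Sum.inr) t := fun i => hf (Sum.inr i)

/-- All matrix entries have positive degree, hence no constant term. This is what makes mapping
cones minimal. -/
theorem IsGraded.constantCoeff_eq_zero {ι κ : Type*} [Fintype ι] {deg : ι → ℤ} {deg' : κ → ℤ}
    {φ : (ι → MvPolynomial σ k) →ₗ[MvPolynomial σ k] (κ → MvPolynomial σ k)}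
    (hφ : IsGraded deg deg' φ) (h : ∀ b c, deg' c < deg b) (f : ι → MvPolynomial σ k) (c : κ) :
    constantCoeff (φ f c) = 0 := by
  classical
  rw [linearMap_apply_eq_sum, map_sum]
  refine Finset.sum_eq_zero fun b _ => ?_
  rw [map_mul, (hφ.entry b c).constantCoeff_eq_zero (by have := h b c; omega), mul_zero]

section Cone

variable (F : FreeRes I) (K : FreeRes J)
  (φ : ∀ q, (K.ι q → MvPolynomial σ k) →ₗ[MvPolynomial σ k] (F.ι q → MvPolynomial σ k))

/-- The degrees in a mapping cone. -/
def coneDeg (D : ℤ) : ∀ q, coneIndex F.ι K.ι q → ℤ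
  | 0 => F.deg 0
  | q + 1 => Sum.elim (F.deg (q + 1)) (fun b => K.deg q b + D)

/-- The lowest differential of a mapping cone. -/
noncomputable def coneHead {ι κ γ : Type*}
    (d : (ι → MvPolynomial σ k) →ₗ[MvPolynomial σ k] (γ → MvPolynomial σ k))
    (ψ : (κ → MvPolynomial σ k) →ₗ[MvPolynomial σ k] (γ → MvPolynomial σ k)) :
    (ι ⊕ κ → MvPolynomial σ k) →ₗ[MvPolynomial σ k] (γ → MvPolynomial σ k) :=
  d ∘ₗ LinearMap.funLeft _ _ Sum.inl + ψ ∘ₗ LinearMap.funLeft _ _ Sum.inr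

/-- The higher differentials of a mapping cone. -/
noncomputable def coneTail {ι κ γ δ : Type*}
    (d : (ι → MvPolynomial σ k) →ₗ[MvPolynomial σ k] (γ → MvPolynomial σ k))
    (ψ : (κ → MvPolynomial σ k) →ₗ[MvPolynomial σ k] (γ → MvPolynomial σ k))
    (d' : (κ → MvPolynomial σ k) →ₗ[MvPolynomial σ k] (δ → MvPolynomial σ k)) :
    (ι ⊕ κ → MvPolynomial σ k) →ₗ[MvPolynomial σ k] (γ ⊕ δ → MvPolynomial σ k) :=
  (LinearEquiv.sumArrowLequivProdArrow γ δ (MvPolynomial σ k)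
      (MvPolynomial σ k)).symm.toLinearMap ∘ₗ
    (coneHead d ψ).prod (-(d' ∘ₗ LinearMap.funLeft _ _ Sum.inr))

theorem coneHead_elim {ι κ γ : Type*}
    (d : (ι → MvPolynomial σ k) →ₗ[MvPolynomial σ k] (γ → MvPolynomial σ k))
    (ψ : (κ → MvPolynomial σ k) →ₗ[MvPolynomial σ k] (γ → MvPolynomial σ k))
    (x : ι → MvPolynomial σ k) (y : κ → MvPolynomial σ k) :
    coneHead d ψ (Sum.elim x y) = d x + ψ y := rfl

theorem coneTail_elim {ι κ γ δ : Type*}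
    (d : (ι → MvPolynomial σ k) →ₗ[MvPolynomial σ k] (γ → MvPolynomial σ k))
    (ψ : (κ → MvPolynomial σ k) →ₗ[MvPolynomial σ k] (γ → MvPolynomial σ k))
    (d' : (κ → MvPolynomial σ k) →ₗ[MvPolynomial σ k] (δ → MvPolynomial σ k))
    (x : ι → MvPolynomial σ k) (y : κ → MvPolynomial σ k) :
    coneTail d ψ d' (Sum.elim x y) = Sum.elim (d x + ψ y) (-(d' y)) := by
  ext1 c
  rcases c with c | c <;> rfl

theorem exists_eq_sumElim {ι κ : Type*} (f : ι ⊕ κ → MvPolynomial σ k) :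
    ∃ (x : ι → MvPolynomial σ k) (y : κ → MvPolynomial σ k), f = Sum.elim x y :=
  ⟨f ∘ Sum.inl, f ∘ Sum.inr, (Sum.elim_comp_inl_inr f).symm⟩

/-- The differential of a mapping cone. -/
noncomputable def coneD : ∀ q, (coneIndex F.ι K.ι (q + 1) → MvPolynomial σ k) →ₗ[MvPolynomial σ k]
    (coneIndex F.ι K.ι q → MvPolynomial σ k)
  | 0 => coneHead (F.d 0) (φ 0)
  | q + 1 => coneTail (F.d (q + 1)) (φ (q + 1)) (K.d q)

end Cone

/-- Adding a homogeneous element `u` to `I` adds a shifted copy of the resolution of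
`R ⧸ (I : u)`. -/
theorem HasBetti.sup_span_singleton {β γ : ℕ → ℤ → ℕ} (hI : HasBetti I β) (hJ : HasBetti J γ)
    {u : MvPolynomial σ k} {D : ℤ} (hu : IsHomogeneousOfDegree u D)
    (hcolon : ∀ f, u * f ∈ I ↔ f ∈ J)
    (hdeg : ∀ q i j, β q i ≠ 0 → γ q j ≠ 0 → i < j + D) :
    HasBetti (I ⊔ Ideal.span {u})
      (fun q j => β q j + match q with | 0 => 0 | q + 1 => γ q (j - D)) := by
  classical
  obtain ⟨F, hF⟩ := hI
  obtain ⟨K, hK⟩ := hJ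
  obtain ⟨φ, hφ, hφ0, hφs⟩ := F.exists_chainMap K hu fun f hf => (hcolon f).2 hf
  have hlt : ∀ q b c, F.deg q c < K.deg q b + D := by
    intro q b c
    refine hdeg q _ _ ?_ ?_
    · rw [← hF, FreeRes.betti, ← Nat.pos_iff_ne_zero, Finset.card_pos]
      exact ⟨c, by simp⟩
    · rw [← hK, FreeRes.betti, ← Nat.pos_iff_ne_zero, Finset.card_pos]
      exact ⟨b, by simp⟩
  have hmin : ∀ q f c, constantCoeff (φ q f c) = 0 := fun q f c =>
    (hφ q).constantCoeff_eq_zero (hlt q) f c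
  have hFd : ∀ q x, F.d q (F.d (q + 1) x) = 0 := fun q x => (F.exact_d q _).2 ⟨x, rfl⟩
  have hKd : ∀ q x, K.d q (K.d (q + 1) x) = 0 := fun q x => (K.exact_d q _).2 ⟨x, rfl⟩
  let fin : ∀ i, Fintype (coneIndex F.ι K.ι i)
    | 0 => inferInstanceAs (Fintype (F.ι 0))
    | q + 1 => inferInstanceAs (Fintype (F.ι (q + 1) ⊕ K.ι q))
  refine ⟨{
    ι := coneIndex F.ι K.ι
    fintype := fin
    deg := coneDeg F K D
    d := coneD F K φ
    aug := F.aug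
    d_graded := ?_
    aug_graded := F.aug_graded
    aug_surjective := F.aug_surjective
    exact_aug := ?_
    exact_d := ?_
    minimal := ?_ }, ?_⟩
  · intro q t f hf
    rcases q with _ | q
    · intro c
      exact (F.d_graded 0 t _ (InFreeDegree.inl hf) c).add (hφ 0 t _ (InFreeDegree.inr hf) c)
    · rintro (c | c)
      · exact (F.d_graded _ t _ (InFreeDegree.inl hf) c).add (hφ _ t _ (InFreeDegree.inr hf) c)
      · exact ((K.d_graded q).add_const t _ (InFreeDegree.inr hf) c).neg
  · have key : ∀ f : F.ι 0 → MvPolynomial σ k, F.aug f () ∈ I ⊔ Ideal.span {u} ↔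
        ∃ g, coneHead (F.d 0) (φ 0) g = f := by
      intro f
      rw [Submodule.mem_sup]
      constructor
      · rintro ⟨y, hy, z, hz, hyz⟩
        obtain ⟨r, rfl⟩ := Ideal.mem_span_singleton'.1 hz
        obtain ⟨x, hx⟩ := K.aug_surjective (fun _ => r)
        have : F.aug (f - φ 0 x) () ∈ I := by
          rw [map_sub, hφ0, hx, Pi.sub_apply, ← hyz]
          convert hy using 1
          simp [mul_comm]
        obtain ⟨g, hg⟩ := (F.exact_aug _).1 this
        refine ⟨Sum.elim g x, ?_⟩
        rw [coneHead_elim, hg, sub_add_cancel]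
      · rintro ⟨g, rfl⟩
        obtain ⟨x, y, rfl⟩ := exists_eq_sumElim g
        rw [coneHead_elim]
        refine ⟨_, (F.exact_aug _).2 ⟨x, rfl⟩, F.aug (φ 0 y) (), ?_, ?_⟩
        · rw [hφ0]
          exact Ideal.mul_mem_right _ _ (Ideal.mem_span_singleton_self u)
        · rw [map_add]; rfl
    exact key
  · have key0 : ∀ f, coneHead (F.d 0) (φ 0) f = 0 ↔
        ∃ g, coneTail (F.d 1) (φ 1) (K.d 0) g = f := by
      intro f
      constructor
      · intro h
        obtain ⟨x, y, rfl⟩ := exists_eq_sumElim f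
        rw [coneHead_elim] at h
        -- Since `φ 0 y` is a boundary of `F`, `u` times the augmentation of `y` lies in `I`; so
        -- that augmentation lies in the colon ideal `J`, and `y` is a boundary.
        obtain ⟨y', rfl⟩ : ∃ y', K.d 0 y' = y := by
          refine (K.exact_aug _).1 ((hcolon _).1 ?_)
          have h3 : F.aug (F.d 0 (-x)) () ∈ I := (F.exact_aug _).2 ⟨_, rfl⟩
          rw [map_neg, ← eq_neg_of_add_eq_zero_right h, hφ0] at h3
          exact h3
        have h2 : F.d 0 (x + φ 1 y') = 0 := by rw [map_add, hφs, h]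
        obtain ⟨x', hx'⟩ := (F.exact_d 0 _).1 h2
        -- The sign of `y'` cancels the sign of the second component of `coneTail`.
        refine ⟨Sum.elim x' (-y'), ?_⟩
        rw [coneTail_elim, hx', map_neg, map_neg, add_neg_cancel_right, neg_neg]
      · rintro ⟨g, rfl⟩
        obtain ⟨x, y, rfl⟩ := exists_eq_sumElim g
        rw [coneTail_elim, coneHead_elim, map_add, map_neg, hFd, hφs, zero_add, add_neg_cancel]
    have keys : ∀ q f, coneTail (F.d (q + 1)) (φ (q + 1)) (K.d q) f = 0 ↔
        ∃ g, coneTail (F.d (q + 2)) (φ (q + 2)) (K.d (q + 1)) g = f := by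
      intro q f
      constructor
      · intro h
        obtain ⟨x, y, rfl⟩ := exists_eq_sumElim f
        rw [coneTail_elim] at h
        have hl : F.d (q + 1) x + φ (q + 1) y = 0 := congrArg (fun g => g ∘ Sum.inl) h
        have hr : -(K.d q y) = 0 := congrArg (fun g => g ∘ Sum.inr) h
        obtain ⟨y', rfl⟩ := (K.exact_d q y).1 (neg_eq_zero.1 hr)
        have h2 : F.d (q + 1) (x + φ (q + 2) y') = 0 := by rw [map_add, hφs, hl]
        obtain ⟨x', hx'⟩ := (F.exact_d (q + 1) _).1 h2
        refine ⟨Sum.elim x' (-y'), ?_⟩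
        rw [coneTail_elim, hx', map_neg, map_neg, add_neg_cancel_right, neg_neg]
      · rintro ⟨g, rfl⟩
        obtain ⟨x, y, rfl⟩ := exists_eq_sumElim g
        rw [coneTail_elim, coneTail_elim, map_add, map_neg, hFd, hφs, zero_add, add_neg_cancel,
          map_neg, hKd, neg_zero, neg_zero]
        exact Sum.elim_zero_zero
    intro q
    rcases q with _ | q
    exacts [key0, keys q]
  · intro q f b
    rcases q with _ | q
    · refine (map_add constantCoeff _ _).trans ?_
      exact (congrArg₂ _ (F.minimal _ _ _) (hmin _ _ _)).trans (add_zero 0)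
    · rcases b with b | b
      · refine (map_add constantCoeff _ _).trans ?_
        exact (congrArg₂ _ (F.minimal _ _ _) (hmin _ _ _)).trans (add_zero 0)
      · refine (map_neg constantCoeff _).trans ?_
        exact neg_eq_zero.2 (K.minimal _ _ _)
  · intro q j
    rcases q with _ | q
    · exact hF 0 j
    · have h1 : (Finset.univ.filter fun b : F.ι (q + 1) ⊕ K.ι q =>
          Sum.elim (F.deg (q + 1)) (fun b => K.deg q b + D) b = j) =
          (Finset.univ.filter fun b => F.deg (q + 1) b = j).disjSum
            (Finset.univ.filter fun b => K.deg q b = j - D) := by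
        ext b
        rcases b with b | b
        · simp
        · simp [eq_sub_iff_add_eq]
      have h2 := congrArg Finset.card h1
      rw [Finset.card_disjSum] at h2
      refine Eq.trans ?_ (h2.trans (congrArg₂ _ (hF _ _) (hK _ _)))
      rfl

/-- An ideal with a graded resolution is homogeneous, because taking components commutes with the
augmentation and with `d 0`. It supplies the hypothesis of
`MinimalGradedFreeResolution.betti_unique`. -/
theorem FreeRes.intComponent_mem (F : FreeRes I) {f : MvPolynomial σ k} (hf : f ∈ I) (t : ℤ) :
    intComponent t f ∈ I := by
  obtain ⟨x, hx⟩ := F.aug_surjective (fun _ => f)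
  obtain ⟨y, rfl⟩ := (F.exact_aug x).1 (by rwa [hx])
  have h1 : F.aug (F.d 0 (freeComponent (F.deg 1) t y)) () ∈ I := (F.exact_aug _).2 ⟨_, rfl⟩
  rw [(F.d_graded 0).map_freeComponent, F.aug_graded.map_freeComponent, hx] at h1
  simpa [freeComponent] using h1

end Resolution

/-! ### Uniqueness of graded Betti numbers -/

section Uniqueness

variable {k : Type*} [Field k] {σ : Type*} {ι κ : Type*}

/-- A graded endomorphism of a graded free module that is the identity modulo `𝔪` is bijective. -/
theorem IsGraded.bijective_of_sub_mem [Fintype ι] {deg : ι → ℤ}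
    {θ : (ι → MvPolynomial σ k) →ₗ[MvPolynomial σ k] (ι → MvPolynomial σ k)}
    (hθ : IsGraded deg deg θ) (h : ∀ f b, constantCoeff (θ f b) = constantCoeff (f b)) :
    Function.Bijective θ := by
  classical
  set M := LinearMap.toMatrix' θ with hM
  have hentry : ∀ c b, M c b = θ (Pi.single b 1) c := by
    intro c b
    rw [hM, LinearMap.toMatrix'_apply]
  have hone : M.map constantCoeff = 1 := by
    ext c b
    rw [Matrix.map_apply, hentry, h, Matrix.one_apply, Pi.single_apply]
    split_ifs <;> simp
  -- In each term of the determinant the degrees `deg b - deg (τ b)` sum to zero. So the determinant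
  -- is a constant, and it can be computed modulo `𝔪`.
  have hhom : IsHomogeneousOfDegree M.det 0 := by
    rw [Matrix.det_apply]
    refine IsHomogeneousOfDegree.sum fun τ _ => ?_
    have h1 : IsHomogeneousOfDegree (∏ b, M (τ b) b) (∑ b, (deg b - deg (τ b))) :=
      IsHomogeneousOfDegree.prod fun b _ => by
        rw [hentry]
        exact hθ.entry b (τ b)
    rw [Finset.sum_sub_distrib, Equiv.sum_comp τ deg, sub_self] at h1
    rcases Int.units_eq_one_or (Equiv.Perm.sign τ) with hs | hs
    · rw [hs, one_smul]
      exact h1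
    · rw [hs, Units.neg_smul, one_smul]
      exact h1.neg
  have hdet : M.det = 1 := by
    rw [hhom.eq_C, RingHom.map_det, RingHom.mapMatrix_apply, hone, Matrix.det_one, map_one]
  have hunit : IsUnit θ := by
    have := (Matrix.isUnit_iff_isUnit_det M).2 (by rw [hdet]; exact isUnit_one)
    have h2 := this.map (Matrix.toLinAlgEquiv' (R := MvPolynomial σ k) (n := ι))
    have h3 : Matrix.toLinAlgEquiv' M = θ := Matrix.toLin'_toMatrix' θ
    rwa [h3] at h2
  exact (Module.End.isUnit_iff θ).1 hunit

/-- Modulo `𝔪`, the parts of `φ` and `ψ` in degree `j` are matrices `A`, `B` over the field with `B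
* A = 1`; comparing ranks gives the inequality. -/
theorem IsGraded.card_le [Fintype ι] [Fintype κ] {deg : ι → ℤ} {deg' : κ → ℤ}
    {φ : (ι → MvPolynomial σ k) →ₗ[MvPolynomial σ k] (κ → MvPolynomial σ k)}
    {ψ : (κ → MvPolynomial σ k) →ₗ[MvPolynomial σ k] (ι → MvPolynomial σ k)}
    (hφ : IsGraded deg deg' φ)
    (h : ∀ f b, constantCoeff (ψ (φ f) b) = constantCoeff (f b)) (j : ℤ) :
    (Finset.univ.filter fun b => deg b = j).card ≤ (Finset.univ.filter fun b => deg' b = j).card := by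
  classical
  let A : Matrix {c // deg' c = j} {b // deg b = j} k :=
    fun c b => constantCoeff (φ (Pi.single b.1 1) c.1)
  let B : Matrix {b // deg b = j} {c // deg' c = j} k :=
    fun b c => constantCoeff (ψ (Pi.single c.1 1) b.1)
  have hBA : B * A = 1 := by
    ext b b'
    rw [Matrix.mul_apply, Matrix.one_apply]
    have h1 := h (Pi.single b'.1 1) b.1
    rw [linearMap_apply_eq_sum, map_sum] at h1
    rw [show (∑ c, B b c * A c b') = ∑ c : {c // deg' c = j},
      constantCoeff (φ (Pi.single b'.1 1) c.1 * ψ (Pi.single c.1 1) b.1) from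
      Finset.sum_congr rfl fun c _ => by rw [map_mul, mul_comm]]
    -- Entries between basis elements of different degrees have no constant term, so only the `c` of
    -- degree `j` contribute.
    rw [← Fintype.sum_subtype_add_sum_subtype (fun c => deg' c = j),
      Finset.sum_eq_zero (s := (Finset.univ : Finset {c // ¬ deg' c = j})), add_zero] at h1
    · rw [h1, Pi.single_apply]
      by_cases hb : b = b'
      · simp [hb]
      · rw [if_neg hb, if_neg (fun h => hb (Subtype.ext h)), map_zero]
    · intro c _
      rw [map_mul, (hφ.entry b'.1 c.1).constantCoeff_eq_zero, zero_mul]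
      have := b'.2
      have := c.2
      omega
  rw [← Fintype.card_subtype, ← Fintype.card_subtype]
  calc Fintype.card {b // deg b = j} = (B * A).rank := by rw [hBA, Matrix.rank_one]
    _ ≤ B.rank := Matrix.rank_mul_le_left B A
    _ ≤ Fintype.card {c // deg' c = j} := Matrix.rank_le_card_width B

/-- Uniqueness of minimal covers of a graded module. -/
theorem exists_graded_bijection {γ : Type*} [Fintype ι] [Fintype κ] {deg : ι → ℤ} {deg' : κ → ℤ}
    {deg'' : γ → ℤ}
    {p : (ι → MvPolynomial σ k) →ₗ[MvPolynomial σ k] (γ → MvPolynomial σ k)}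
    {p' : (κ → MvPolynomial σ k) →ₗ[MvPolynomial σ k] (γ → MvPolynomial σ k)}
    (hp : IsGraded deg deg'' p) (hp' : IsGraded deg' deg'' p')
    (W : Submodule (MvPolynomial σ k) (γ → MvPolynomial σ k))
    (hW : ∀ t, ∀ w ∈ W, freeComponent deg'' t w ∈ W)
    (h : ∀ f, ∃ g, p' g - p f ∈ W) (h' : ∀ g, ∃ f, p f - p' g ∈ W)
    (hmin : ∀ f, p f ∈ W → ∀ b, constantCoeff (f b) = 0)
    (hmin' : ∀ f, p' f ∈ W → ∀ b, constantCoeff (f b) = 0) :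
    ∃ φ : (ι → MvPolynomial σ k) →ₗ[MvPolynomial σ k] (κ → MvPolynomial σ k),
      IsGraded deg deg' φ ∧ Function.Bijective φ ∧ (∀ f, p' (φ f) - p f ∈ W) ∧
      ∀ j, (Finset.univ.filter fun b => deg b = j).card =
        (Finset.univ.filter fun b => deg' b = j).card := by
  obtain ⟨φ, hφ, hφ'⟩ := exists_graded_lift hp' hp W hW h
  obtain ⟨ψ, hψ, hψ'⟩ := exists_graded_lift hp hp' W hW h'
  have h1 : ∀ f b, constantCoeff (ψ (φ f) b) = constantCoeff (f b) := by
    intro f b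
    have h2 : p (ψ (φ f) - f) ∈ W := by
      rw [map_sub]
      simpa using W.add_mem (hψ' (φ f)) (hφ' f)
    have h3 := hmin _ h2 b
    rwa [Pi.sub_apply, map_sub, sub_eq_zero] at h3
  have h2 : ∀ f b, constantCoeff (φ (ψ f) b) = constantCoeff (f b) := by
    intro f b
    have h2 : p' (φ (ψ f) - f) ∈ W := by
      rw [map_sub]
      simpa using W.add_mem (hφ' (ψ f)) (hψ' f)
    have h3 := hmin' _ h2 b
    rwa [Pi.sub_apply, map_sub, sub_eq_zero] at h3
  have b1 := (hψ.comp hφ).bijective_of_sub_mem h1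
  have b2 := (hφ.comp hψ).bijective_of_sub_mem h2
  exact ⟨φ, hφ, ⟨Function.Injective.of_comp (f := ψ) b1.1, Function.Surjective.of_comp (g := ψ) b2.2⟩,
    hφ', fun j => le_antisymm (hφ.card_le h1 j) (hψ.card_le h2 j)⟩

variable {I : Ideal (MvPolynomial σ k)}

/-- Homogeneous representatives of the images of the basis vectors define the lift. It brings the
augmentation within reach of the results on maps of free modules. -/
theorem MinimalGradedFreeResolution.exists_lift_aug (F : MinimalGradedFreeResolution I) :
    ∃ α : (Fin (F.rank 0) → MvPolynomial σ k) →ₗ[MvPolynomial σ k] (Unit → MvPolynomial σ k),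
      IsGraded (F.deg 0) (fun _ => 0) α ∧ ∀ f, Ideal.Quotient.mk I (α f ()) = F.aug f := by
  choose g hg hg' using fun b => F.aug_graded _ _ (inFreeDegree_single (k := k) (σ := σ) (F.deg 0) b)
  refine ⟨Fintype.linearCombination (MvPolynomial σ k) fun b _ => g b,
    isGraded_of_entry fun b c => ?_, fun f => ?_⟩
  · simpa using hg b
  · have hf : f = ∑ b, f b • (Pi.single b 1 : Fin (F.rank 0) → MvPolynomial σ k) := by
      ext1 c
      simp [Finset.sum_apply, Pi.single_apply]
    conv_rhs => rw [hf, map_sum]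
    rw [Fintype.linearCombination_apply, Finset.sum_apply, map_sum]
    refine Finset.sum_congr rfl fun b _ => ?_
    rw [map_smul, ← hg', Pi.smul_apply, smul_eq_mul, map_mul]
    rfl

/-- Any two minimal graded free resolutions have the same graded Betti numbers. -/
theorem MinimalGradedFreeResolution.betti_unique
    (hI : ∀ f ∈ I, ∀ t, intComponent t f ∈ I) (F G : MinimalGradedFreeResolution I)
    (q : ℕ) (j : ℤ) : F.betti q j = G.betti q j := by
  -- The induction needs more than the Betti numbers: an isomorphism of the `q`-th modules that also
  -- matches the images of the differentials into them.
  suffices h : ∃ φ : (Fin (F.rank q) → MvPolynomial σ k) →ₗ[MvPolynomial σ k]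
      (Fin (G.rank q) → MvPolynomial σ k), IsGraded (F.deg q) (G.deg q) φ ∧
      Function.Bijective φ ∧ (∀ f, f ∈ Set.range (F.d q) ↔ φ f ∈ Set.range (G.d q)) ∧
      ∀ j, F.betti q j = G.betti q j by
    obtain ⟨-, -, -, -, h⟩ := h
    exact h j
  have hmin : ∀ (F : MinimalGradedFreeResolution I) (q : ℕ) (f : Fin (F.rank q) → MvPolynomial σ k),
      f ∈ Set.range (F.d q) → ∀ b, constantCoeff (f b) = 0 :=
    fun F q f hf => mem_irrelevant_smul_top.1 (F.minimal q hf)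
  induction q with
  | zero =>
    obtain ⟨α, hα, hα'⟩ := F.exists_lift_aug
    obtain ⟨α', hα₁, hα₁'⟩ := G.exists_lift_aug
    -- The quotient `R ⧸ I` is not free, so the two covers are compared as maps to `R` modulo `I`.
    let W : Submodule (MvPolynomial σ k) (Unit → MvPolynomial σ k) :=
      Submodule.comap (LinearMap.proj ()) I
    have hsub : ∀ x y : Unit → MvPolynomial σ k, x - y ∈ W ↔
        Ideal.Quotient.mk I (x ()) = Ideal.Quotient.mk I (y ()) := by
      intro x y
      rw [Ideal.Quotient.eq]
      rfl
    have hmem : ∀ x : Unit → MvPolynomial σ k, x ∈ W ↔ Ideal.Quotient.mk I (x ()) = 0 := by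
      intro x
      rw [Ideal.Quotient.eq_zero_iff_mem]
      rfl
    obtain ⟨φ, h1, h2, h3, h4⟩ := exists_graded_bijection hα hα₁ W
      (fun t w hw => by
        have := hI _ hw (t - 0)
        exact this)
      (fun f => by
        obtain ⟨g, hg⟩ := G.aug_surjective (F.aug f)
        exact ⟨g, by rw [hsub, hα', hα₁', hg]⟩)
      (fun f => by
        obtain ⟨g, hg⟩ := F.aug_surjective (G.aug f)
        exact ⟨g, by rw [hsub, hα', hα₁', hg]⟩)
      (fun f hf => hmin F 0 f ((F.exact_aug f).1 (by rwa [hmem, hα'] at hf)))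
      (fun f hf => hmin G 0 f ((G.exact_aug f).1 (by rwa [hmem, hα₁'] at hf)))
    refine ⟨φ, h1, h2, fun f => ?_, h4⟩
    have h5 := (hsub _ _).1 (h3 f)
    rw [hα', hα₁'] at h5
    rw [← F.exact_aug f, ← G.exact_aug (φ f), h5]
  | succ q ih =>
    obtain ⟨φ, h1, h2, h3, -⟩ := ih
    -- Through `φ`, both differentials become minimal covers of the same submodule of the `q`-th
    -- module of `G`, compared with `W = ⊥`.
    have hmap : ∀ x, φ x = 0 ↔ x = 0 := fun x => map_eq_zero_iff φ h2.1
    obtain ⟨φ', h1', h2', h3', h4'⟩ := exists_graded_bijection (p := φ ∘ₗ F.d q) (p' := G.d q)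
      (h1.comp (F.d_graded q)) (G.d_graded q) ⊥
      (by
        intro t w hw
        rw [Submodule.mem_bot] at hw ⊢
        subst hw
        ext1 b
        simp [freeComponent])
      (fun f => by
        obtain ⟨g, hg⟩ := (h3 _).1 ⟨f, rfl⟩
        exact ⟨g, by simp [hg]⟩)
      (fun g => by
        obtain ⟨x, hx⟩ := h2.2 (G.d q g)
        obtain ⟨f, rfl⟩ := (h3 x).2 ⟨g, hx.symm⟩
        exact ⟨f, by simp [hx]⟩)
      (fun f hf => hmin F (q + 1) f ((F.exact_d q f).1 (by
        rwa [Submodule.mem_bot, LinearMap.comp_apply, hmap] at hf)))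
      (fun f hf => hmin G (q + 1) f ((G.exact_d q f).1 (by rwa [Submodule.mem_bot] at hf)))
    refine ⟨φ', h1', h2', fun f => ?_, h4'⟩
    have h5 := h3' f
    rw [Submodule.mem_bot, sub_eq_zero] at h5
    rw [← F.exact_d q f, ← G.exact_d q (φ' f), h5, LinearMap.comp_apply, hmap]

end Uniqueness

/-! ### From arbitrary finite index types to `Fin` -/

section Conversion

variable {k : Type*} [Field k] {σ : Type*} {I : Ideal (MvPolynomial σ k)}

theorem FreeRes.exists_minimalGradedFreeResolution (F : FreeRes I) :
    ∃ G : MinimalGradedFreeResolution I, ∀ q j, G.betti q j = F.betti q j := by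
  let e : ∀ q, F.ι q ≃ Fin (Fintype.card (F.ι q)) := fun q => Fintype.equivFin _
  let E : ∀ q, (Fin (Fintype.card (F.ι q)) → MvPolynomial σ k) ≃ₗ[MvPolynomial σ k]
      (F.ι q → MvPolynomial σ k) := fun q => LinearEquiv.funCongrLeft _ _ (e q)
  have hE : ∀ q t f, InFreeDegree (fun b => F.deg q ((e q).symm b)) f t →
      InFreeDegree (F.deg q) (E q f) t := by
    intro q t f hf b
    have := hf (e q b)
    simp only [Equiv.symm_apply_apply] at this
    exact this
  have hmkaug : ∀ f, Ideal.Quotient.mk I (F.aug f ()) = 0 ↔ ∃ g, F.d 0 g = f := by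
    intro f
    rw [Ideal.Quotient.eq_zero_iff_mem, F.exact_aug]
  refine ⟨{
    rank := fun q => Fintype.card (F.ι q)
    deg := fun q b => F.deg q ((e q).symm b)
    d := fun q => (E q).symm.toLinearMap ∘ₗ F.d q ∘ₗ (E (q + 1)).toLinearMap
    aug := I.mkQ ∘ₗ LinearMap.proj () ∘ₗ F.aug ∘ₗ (E 0).toLinearMap
    d_graded := fun q t f hf b => F.d_graded q t _ (hE _ _ _ hf) ((e q).symm b)
    aug_graded := fun t f hf => ⟨F.aug (E 0 f) (), by
      simpa using F.aug_graded t _ (hE _ _ _ hf) (), rfl⟩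
    aug_surjective := fun x => by
      obtain ⟨r, rfl⟩ := Ideal.Quotient.mk_surjective x
      obtain ⟨y, hy⟩ := F.aug_surjective (fun _ => r)
      refine ⟨(E 0).symm y, ?_⟩
      simp only [LinearMap.comp_apply, LinearEquiv.coe_coe, LinearEquiv.apply_symm_apply, hy]
      rfl
    exact_aug := fun f => by
      refine (hmkaug (E 0 f)).trans ?_
      constructor
      · rintro ⟨g, hg⟩
        exact ⟨(E 1).symm g, by simp [hg]⟩
      · rintro ⟨g, hg⟩
        exact ⟨E 1 g, by simp [← hg]⟩
    exact_d := fun q f => by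
      have := F.exact_d q (E (q + 1) f)
      rw [LinearMap.comp_apply, LinearEquiv.coe_coe, LinearEquiv.map_eq_zero_iff,
        LinearMap.comp_apply, LinearEquiv.coe_coe, this]
      constructor
      · rintro ⟨g, hg⟩
        exact ⟨(E (q + 2)).symm g, by simp [hg]⟩
      · rintro ⟨g, hg⟩
        exact ⟨E (q + 2) g, by simp [← hg]⟩
    minimal := by
      rintro q - ⟨f, rfl⟩
      rw [mem_irrelevant_smul_top]
      intro b
      exact F.minimal q _ _ }, fun q j => ?_⟩
  unfold MinimalGradedFreeResolution.betti FreeRes.betti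
  refine Finset.card_equiv (e q).symm fun b => ?_
  simp

end Conversion

/-! ### Monomial ideals with linear quotients -/

section Monomial

variable {k : Type*} [Field k] {σ : Type*}

/-- The monomial ideal generated by the monomials with exponents in `A`. -/
noncomputable def monSpan (k : Type*) [Field k] {σ : Type*} (A : Set (σ →₀ ℕ)) :
    Ideal (MvPolynomial σ k) :=
  Ideal.span ((fun m => monomial m (1 : k)) '' A)

theorem mem_monSpan {A : Set (σ →₀ ℕ)} {f : MvPolynomial σ k} :
    f ∈ monSpan k A ↔ ∀ m ∈ f.support, ∃ v ∈ A, v ≤ m :=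
  mem_ideal_span_monomial_image

theorem monSpan_insert (u : σ →₀ ℕ) (A : Set (σ →₀ ℕ)) :
    monSpan k (insert u A) = monSpan k A ⊔ Ideal.span {monomial u 1} := by
  rw [monSpan, Set.image_insert_eq, Ideal.span_insert, sup_comm]
  rfl

/-- The Betti numbers of a Koszul complex on `c` linear forms, shifted by `D` and by one
homological degree. -/
def koszulBetti (c D q : ℕ) (j : ℤ) : ℕ :=
  if 1 ≤ q ∧ j = (q : ℤ) - 1 + D then c.choose (q - 1) else 0

theorem HasBetti.congr {I J : Ideal (MvPolynomial σ k)} {β γ : ℕ → ℤ → ℕ} (h : HasBetti I β)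
    (hIJ : I = J) (hβ : ∀ q j, β q j = γ q j) : HasBetti J γ := by
  subst hIJ
  obtain ⟨F, hF⟩ := h
  exact ⟨F, fun q j => (hF q j).trans (hβ q j)⟩

/-- The Koszul resolution of an ideal generated by variables. -/
theorem hasBetti_span_X (S : Finset σ) :
    HasBetti (Ideal.span ((X : σ → MvPolynomial σ k) '' S))
      (fun q j => if j = q then S.card.choose q else 0) := by
  classical
  induction S using Finset.induction_on with
  | empty =>
    refine hasBetti_bot.congr (by simp) fun q j => ?_
    rcases q with _ | q
    · simp
    · simp
  | insert s S hs ih =>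
    have hX : IsHomogeneousOfDegree (X s : MvPolynomial σ k) 1 := by
      simpa [X] using isHomogeneousOfDegree_monomial (Finsupp.single s 1) (1 : k)
    -- A new variable is a nonzerodivisor modulo the others, so the colon ideal is the ideal itself
    -- and both resolutions in the cone coincide.
    refine (ih.sup_span_singleton ih hX (fun f => ⟨fun h => ?_, fun h => Ideal.mul_mem_left _ _ h⟩)
      ?_).congr ?_ ?_
    · rw [mem_ideal_span_X_image] at h ⊢
      intro m hm
      obtain ⟨i, hi, hi'⟩ := h (Finsupp.single s 1 + m) (by
        rw [mem_support_iff, coeff_X_mul]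
        exact mem_support_iff.1 hm)
      refine ⟨i, hi, ?_⟩
      have : s ≠ i := by
        rintro rfl
        exact hs hi
      simpa [Finsupp.single_apply, this] using hi'
    · intro q i j hi hj
      simp only [ne_eq, ite_eq_right_iff, Classical.not_imp] at hi hj
      omega
    · rw [Finset.coe_insert, Set.image_insert_eq, Ideal.span_insert, sup_comm]
    · intro q j
      rw [Finset.card_insert_of_notMem hs]
      rcases q with _ | q
      · simp
      · by_cases hj : j = ((q + 1 : ℕ) : ℤ)
        · subst hj
          simp [Nat.choose_succ_succ, add_comm]
        · have : ¬ (j - 1 = q) := by push_cast at hj; omega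
          have h' : ¬ (j = (q : ℤ) + 1) := by push_cast at hj; omega
          simp [this, h']

/-- Membership in both ideals is tested on supports, and multiplication by a monomial translates the
support; so a condition on exponents decides the colon ideal. -/
theorem monomial_mul_mem_monSpan_iff {A : Set (σ →₀ ℕ)} {S : Finset σ} {u : σ →₀ ℕ}
    (h : ∀ w : σ →₀ ℕ, (∃ v ∈ A, v ≤ u + w) ↔ ∃ s ∈ S, w s ≠ 0) (f : MvPolynomial σ k) :
    monomial u 1 * f ∈ monSpan k A ↔ f ∈ Ideal.span ((X : σ → MvPolynomial σ k) '' S) := by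
  classical
  rw [mem_monSpan, mem_ideal_span_X_image]
  constructor
  · intro hf m hm
    refine (h m).1 (hf _ ?_)
    rw [mem_support_iff, coeff_monomial_mul, one_mul]
    exact mem_support_iff.1 hm
  · intro hf m hm
    rw [mem_support_iff, coeff_monomial_mul'] at hm
    split_ifs at hm with hum
    · rw [one_mul] at hm
      have := (h (m - u)).2 (hf _ (mem_support_iff.2 hm))
      rwa [add_tsub_cancel_of_le hum] at this
    · exact absurd rfl hm

/-- One step of linear quotients. The hypothesis `hβ` is the degree gap required for minimality: the
`q`-th module of the shifted Koszul complex is generated in degree `q + u.degree`. -/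
theorem HasBetti.insert_monomial {A : Set (σ →₀ ℕ)} {β : ℕ → ℤ → ℕ} (hA : HasBetti (monSpan k A) β)
    {S : Finset σ} {u : σ →₀ ℕ}
    (h : ∀ w : σ →₀ ℕ, (∃ v ∈ A, v ≤ u + w) ↔ ∃ s ∈ S, w s ≠ 0)
    (hβ : ∀ (q : ℕ) i, β q i ≠ 0 → i < q + (u.degree : ℤ)) :
    HasBetti (monSpan k (insert u A)) (fun q j => β q j + koszulBetti S.card u.degree q j) := by
  refine (hA.sup_span_singleton (hasBetti_span_X S) (isHomogeneousOfDegree_monomial u 1)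
    (monomial_mul_mem_monSpan_iff h) ?_).congr (monSpan_insert u A).symm fun q j => ?_
  · intro q i j hi hj
    simp only [ne_eq, ite_eq_right_iff, Classical.not_imp] at hj
    rw [hj.1]
    exact hβ q i hi
  · unfold koszulBetti
    rcases q with _ | q
    · simp
    · simp only [Nat.le_add_left, true_and, Nat.add_sub_cancel]
      congr 1
      refine if_congr ?_ rfl rfl
      push_cast
      constructor <;> intro <;> omega

variable [DecidableEq σ]

theorem degree_of_mem_finsuppAntidiag {S : Finset σ} {d : ℕ} {m : σ →₀ ℕ}
    (hm : m ∈ S.finsuppAntidiag d) : m.degree = d := by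
  rw [Finset.mem_finsuppAntidiag] at hm
  rw [Finsupp.degree_apply, ← hm.1]
  refine Finset.sum_subset hm.2 fun i _ hi => ?_
  simpa using hi

/-- Induction on `d`: while the degree on `S` is short of that of `m`, some coordinate in `S` can be
raised by one. -/
theorem exists_le_mem_finsuppAntidiag {S : Finset σ} {m : σ →₀ ℕ} (d : ℕ) (hd : d ≤ ∑ s ∈ S, m s) :
    ∃ m' ∈ S.finsuppAntidiag d, m' ≤ m := by
  induction d with
  | zero => exact ⟨0, by simp, bot_le⟩
  | succ d ih =>
    obtain ⟨m', hm', hle⟩ := ih (by omega)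
    rw [Finset.mem_finsuppAntidiag] at hm'
    obtain ⟨s, hs, hlt⟩ := Finset.exists_lt_of_sum_lt
      (show ∑ s ∈ S, m' s < ∑ s ∈ S, m s by
        have : ∑ s ∈ S, m' s = d := hm'.1
        omega)
    refine ⟨m' + Finsupp.single s 1, ?_, ?_⟩
    · rw [Finset.mem_finsuppAntidiag]
      constructor
      · have : ∑ s ∈ S, m' s = d := hm'.1
        change ∑ i ∈ S, (m' i + Finsupp.single s 1 i) = d + 1
        rw [Finset.sum_add_distrib, this]
        simp [Finsupp.single_apply, hs]
      · refine Finsupp.support_add.trans (Finset.union_subset hm'.2 ?_)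
        exact Finsupp.support_single_subset.trans (by simpa using hs)
    · intro i
      by_cases hi : s = i
      · subst hi
        simpa using hlt
      · simpa [Finsupp.single_apply, hi] using hle i

/-- Adding all monomials `z * m` with `m` of degree `d` in the variables from `S`. -/
theorem HasBetti.union_block {A : Set (σ →₀ ℕ)} {β : ℕ → ℤ → ℕ} (hA : HasBetti (monSpan k A) β)
    {S : Finset σ} {z : σ →₀ ℕ} {d : ℕ} (hz : ∀ s ∈ S, z s = 0)
    (h1 : ∀ v ∈ A, d < ∑ s ∈ S, v s)
    (h2 : ∀ m ∈ S.finsuppAntidiag (d + 1), ∃ v ∈ A, v ≤ z + m)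
    (hβ : ∀ (q : ℕ) i, β q i ≠ 0 → i < q + ((z.degree + d : ℕ) : ℤ))
    (T : Finset (σ →₀ ℕ)) (hT : T ⊆ S.finsuppAntidiag d) :
    HasBetti (monSpan k (A ∪ (fun m => z + m) '' T))
      (fun q j => β q j + T.card * koszulBetti S.card (z.degree + d) q j) := by
  induction T using Finset.induction_on with
  | empty => exact hA.congr (by simp) (by simp)
  | insert m T hm ih =>
    have hmS := hT (Finset.mem_insert_self m T)
    have hmS' := Finset.mem_finsuppAntidiag.1 hmS
    have hsum : ∑ s ∈ S, m s = d := hmS'.1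
    have hdeg : (z + m).degree = z.degree + d := by
      rw [map_add, degree_of_mem_finsuppAntidiag hmS]
    have hTS : T ⊆ S.finsuppAntidiag d := (Finset.subset_insert m T).trans hT
    refine ((ih hTS).insert_monomial (S := S) (u := z + m) (fun w => ?_) ?_).congr ?_ ?_
    · constructor
      -- If `w` avoids `S`, the `S`-part of `v` divides `m`. Its degree is too large for `v ∈ A`,
      -- and equal to that of `m` within the block, which would force `m' = m`.
      · rintro ⟨v, hv, hle⟩
        by_contra! hw
        have hle' : ∀ s ∈ S, v s ≤ m s := by
          intro s hs
          have := hle s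
          simpa [hz s hs, hw s hs] using this
        rcases hv with hv | ⟨m', hm', rfl⟩
        · have := h1 v hv
          have := Finset.sum_le_sum hle'
          omega
        · have hm'S := Finset.mem_finsuppAntidiag.1 (hTS hm')
          have hsum' : ∑ s ∈ S, m' s = d := hm'S.1
          have hle'' : ∀ s ∈ S, m' s ≤ m s := fun s hs => by simpa [hz s hs] using hle' s hs
          have heq := (Finset.sum_eq_sum_iff_of_le hle'').1 (hsum'.trans hsum.symm)
          have : m' = m := by
            ext s
            by_cases hs : s ∈ S
            · exact heq s hs
            · rw [Finsupp.notMem_support_iff.1 fun h => hs (hm'S.2 h),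
                Finsupp.notMem_support_iff.1 fun h => hs (hmS'.2 h)]
          subst this
          exact hm hm'
      -- One factor `s` already raises the `S`-degree to `d + 1`, where `h2` finds a divisor in `A`.
      · rintro ⟨s, hs, hw⟩
        obtain ⟨v, hv, hle⟩ := h2 (m + Finsupp.single s 1) (by
          rw [Finset.mem_finsuppAntidiag]
          constructor
          · change ∑ i ∈ S, (m i + Finsupp.single s 1 i) = d + 1
            rw [Finset.sum_add_distrib, hsum]
            simp [Finsupp.single_apply, hs]
          · refine Finsupp.support_add.trans (Finset.union_subset hmS'.2 ?_)
            exact Finsupp.support_single_subset.trans (by simpa using hs))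
        refine ⟨v, Or.inl hv, hle.trans ?_⟩
        rw [add_assoc]
        gcongr
        rw [Finsupp.single_le_iff]
        omega
    · intro q i hi
      rw [hdeg]
      by_cases h0 : β q i = 0
      · have h3 : koszulBetti S.card (z.degree + d) q i ≠ 0 := by
          intro h4
          simp [h0, h4] at hi
        unfold koszulBetti at h3
        split_ifs at h3 with h4
        · omega
        · exact absurd rfl h3
      · exact hβ q i h0
    · rw [Finset.coe_insert, Set.image_insert_eq, Set.union_insert]
    · intro q j
      rw [hdeg, Finset.card_insert_of_notMem hm]
      ring

/-- The exponents `z e + m`, `e ≤ E`, with `m` of degree `a - e` in the variables from `S`. -/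
def chainSet (S : Finset σ) (a : ℕ) (z : ℕ → σ →₀ ℕ) (E : ℕ) : Set (σ →₀ ℕ) :=
  {v | ∃ e ≤ E, ∃ m ∈ S.finsuppAntidiag (a - e), v = z e + m}

/-- Block `e` consists of `z e` times the monomials of degree `a - e` in `S`. By `hmono`, a variable
of `S` times a generator of block `e + 1` falls into the ideal of block `e`; by `hdeg`, generator
degrees never decrease. The second conjunct keeps the degree bound available for the induction. -/
theorem HasBetti.chain {S : Finset σ} {a : ℕ} {z : ℕ → σ →₀ ℕ} (hz0 : z 0 = 0)
    (hz : ∀ e, ∀ s ∈ S, z e s = 0) (hmono : ∀ e, z e ≤ z (e + 1))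
    (hdeg : ∀ e, e < a → (z e).degree + 1 ≤ (z (e + 1)).degree)
    {β : ℕ → ℤ → ℕ} (hA : HasBetti (monSpan k (S.finsuppAntidiag a : Set (σ →₀ ℕ))) β)
    (hβ : ∀ (q : ℕ) i, β q i ≠ 0 → i < q + (a : ℤ)) (E : ℕ) (hE : E ≤ a) :
    HasBetti (monSpan k (chainSet S a z E)) (fun q j => β q j +
      ∑ e ∈ Finset.Icc 1 E, (S.finsuppAntidiag (a - e)).card *
        koszulBetti S.card ((z e).degree + (a - e)) q j) ∧
    ∀ (q : ℕ) i, β q i + ∑ e ∈ Finset.Icc 1 E, (S.finsuppAntidiag (a - e)).card *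
      koszulBetti S.card ((z e).degree + (a - e)) q i ≠ 0 →
      i < q + (((z E).degree + (a - E) : ℕ) : ℤ) := by
  induction E with
  | zero =>
    constructor
    · refine hA.congr ?_ (by simp)
      congr 1
      ext v
      simp [chainSet, hz0]
    · simpa [hz0] using hβ
  | succ E ih =>
    obtain ⟨ih1, ih2⟩ := ih (by omega)
    have hle : (z E).degree + (a - E) ≤ (z (E + 1)).degree + (a - (E + 1)) := by
      have := hdeg E (by omega)
      omega
    have hlt : ∀ (q : ℕ) i, β q i + ∑ e ∈ Finset.Icc 1 E, (S.finsuppAntidiag (a - e)).card *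
        koszulBetti S.card ((z e).degree + (a - e)) q i ≠ 0 →
        i < q + (((z (E + 1)).degree + (a - (E + 1)) : ℕ) : ℤ) := fun q i hi => by
      have := ih2 q i hi
      omega
    constructor
    · refine (ih1.union_block (S := S) (z := z (E + 1)) (d := a - (E + 1)) (hz _) ?_ ?_ hlt _
        subset_rfl).congr ?_ ?_
      · rintro v ⟨e, he, m, hm, rfl⟩
        have : ∑ s ∈ S, (z e + m) s = a - e := by
          rw [← (Finset.mem_finsuppAntidiag.1 hm).1]
          exact Finset.sum_congr rfl fun s hs => by simp [hz e s hs]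
        omega
      · intro m hm
        refine ⟨z E + m, ⟨E, le_rfl, m, ?_, rfl⟩, ?_⟩
        · rwa [show a - (E + 1) + 1 = a - E by omega] at hm
        · gcongr
          exact hmono E
      · congr 1
        ext v
        constructor
        · rintro (⟨e, he, m, hm, rfl⟩ | ⟨m, hm, rfl⟩)
          · exact ⟨e, by omega, m, hm, rfl⟩
          · exact ⟨E + 1, le_rfl, m, hm, rfl⟩
        · rintro ⟨e, he, m, hm, rfl⟩
          rcases Nat.lt_or_eq_of_le he with he | rfl
          · exact Or.inl ⟨e, by omega, m, hm, rfl⟩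
          · exact Or.inr ⟨m, hm, rfl⟩
      · intro q j
        rw [Finset.sum_Icc_succ_top (by omega), add_assoc]
    · intro q i hi
      rw [Finset.sum_Icc_succ_top (by omega), ← add_assoc] at hi
      by_cases h0 : β q i + ∑ e ∈ Finset.Icc 1 E, (S.finsuppAntidiag (a - e)).card *
        koszulBetti S.card ((z e).degree + (a - e)) q i = 0
      · rw [h0, zero_add] at hi
        have h3 := right_ne_zero_of_mul hi
        unfold koszulBetti at h3
        split_ifs at h3 with h4
        · omega
        · exact absurd rfl h3
      · exact hlt q i h0

theorem sum_range_multichoose (t a : ℕ) :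
    ∑ d ∈ Finset.range (a + 1), t.multichoose d = (t + 1).multichoose a := by
  induction a with
  | zero => simp
  | succ a ih => rw [Finset.sum_range_succ, ih, Nat.multichoose_succ_succ, add_comm]

/-- The powers of an ideal generated by variables, one variable at a time. -/
theorem HasBetti.insert_variable {S : Finset σ} {t : σ} (ht : t ∉ S) {a : ℕ} {β : ℕ → ℤ → ℕ}
    (hA : HasBetti (monSpan k (S.finsuppAntidiag (a + 1) : Set (σ →₀ ℕ))) β)
    (hβ : ∀ (q : ℕ) i, β q i ≠ 0 → i < q + ((a + 1 : ℕ) : ℤ)) :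
    HasBetti (monSpan k ((insert t S).finsuppAntidiag (a + 1) : Set (σ →₀ ℕ)))
      (fun q j => β q j + (S.card + 1).multichoose a * koszulBetti S.card (a + 1) q j) ∧
    ∀ (q : ℕ) i, β q i + (S.card + 1).multichoose a * koszulBetti S.card (a + 1) q i ≠ 0 →
      i < q + ((a + 1 : ℕ) : ℤ) := by
  obtain ⟨h1, h2⟩ := HasBetti.chain (z := fun e => Finsupp.single t e) (by simp)
    (fun e s hs => by
      have : t ≠ s := by rintro rfl; exact ht hs
      simp [this])
    (fun e => by simp) (fun e _ => by simp) hA hβ (a + 1) le_rfl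
  -- With `z e` the `e`-th power of the variable `t`, every block has generator degree `a + 1`, so
  -- only the number of generators has to be summed.
  have hsum : ∀ q j, ∑ e ∈ Finset.Icc 1 (a + 1), (S.finsuppAntidiag (a + 1 - e)).card *
      koszulBetti S.card ((Finsupp.single t e).degree + (a + 1 - e)) q j =
      (S.card + 1).multichoose a * koszulBetti S.card (a + 1) q j := by
    intro q j
    rw [← sum_range_multichoose, Finset.sum_mul]
    refine Finset.sum_nbij' (fun e => a + 1 - e) (fun d => a + 1 - d) ?_ ?_ ?_ ?_ ?_
    · intro e he
      rw [Finset.mem_Icc] at he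
      rw [Finset.mem_range]
      omega
    · intro d hd
      rw [Finset.mem_range] at hd
      rw [Finset.mem_Icc]
      omega
    · intro e he
      rw [Finset.mem_Icc] at he
      omega
    · intro d hd
      rw [Finset.mem_range] at hd
      omega
    · intro e he
      rw [Finset.mem_Icc] at he
      rw [Finset.card_finsuppAntidiag_nat_eq_multichoose, Finsupp.degree_single,
        show e + (a + 1 - e) = a + 1 by omega]
  simp only [hsum] at h1 h2
  constructor
  · refine h1.congr ?_ fun _ _ => rfl
    congr 1
    ext v
    rw [Finset.mem_coe, Finset.mem_finsuppAntidiag_insert ht]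
    have hupd : ∀ (e : ℕ), ∀ g ∈ S.finsuppAntidiag (a + 1 - e),
        Finsupp.update g t e = Finsupp.single t e + g := by
      intro e g hg
      have hgt : g t = 0 := by
        by_contra h
        exact ht ((Finset.mem_finsuppAntidiag.1 hg).2 (Finsupp.mem_support_iff.2 h))
      rw [Finsupp.update_eq_single_add_erase, Finsupp.erase_of_notMem_support (by simpa using hgt)]
    constructor
    · rintro ⟨e, he, m, hm, rfl⟩
      exact ⟨(e, a + 1 - e), by simpa using Nat.add_sub_of_le he, m, (hupd e m hm).symm, hm⟩
    · rintro ⟨⟨e, d⟩, hed, g, rfl, hg⟩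
      rw [Finset.HasAntidiagonal.mem_antidiagonal] at hed
      obtain rfl : d = a + 1 - e := by simp only at hed; omega
      exact ⟨e, by simp only at hed; omega, g, hg, hupd e g hg⟩
  · intro q i hi
    have := h2 q i hi
    simpa using this

end Monomial

/-! ### The monomial ideal of two coordinate fat points -/

section FinalIdeal

variable {k : Type*} [Field k]

/-- The first `t` of the `n + 1` variables. -/
def firstVars (n t : ℕ) : Finset (Fin (n + 1)) := Finset.univ.filter fun s => s.val < t

theorem card_firstVars {n t : ℕ} (ht : t ≤ n + 1) : (firstVars n t).card = t := by
  rw [firstVars, Fin.card_filter_val_lt, min_eq_right ht]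

theorem firstVars_succ {n t : ℕ} (ht : t < n + 1) :
    firstVars n (t + 1) = insert ⟨t, ht⟩ (firstVars n t) := by
  ext s
  simp [firstVars, Fin.ext_iff]
  omega

/-- The exponent is positive so that with no variables the ideal is zero, which starts the
induction. The variable of index `s` contributes Koszul complexes on the `s` variables before it. -/
theorem hasBetti_power (n a t : ℕ) (ht : t ≤ n) :
    HasBetti (monSpan k ((firstVars n t).finsuppAntidiag (a + 1) : Set (Fin (n + 1) →₀ ℕ)))
      (fun q j => (if q = 0 ∧ j = 0 then 1 else 0) +
        ∑ s ∈ Finset.range t, (s + 1).multichoose a * koszulBetti s (a + 1) q j) ∧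
    ∀ (q : ℕ) i, (if q = 0 ∧ i = 0 then 1 else 0) +
        ∑ s ∈ Finset.range t, (s + 1).multichoose a * koszulBetti s (a + 1) q i ≠ 0 →
      i < q + ((a + 1 : ℕ) : ℤ) := by
  induction t with
  | zero =>
    constructor
    · refine hasBetti_bot.congr ?_ (by simp)
      have : firstVars n 0 = ∅ := by simp [firstVars]
      rw [this, Finset.finsuppAntidiag_empty_of_ne_zero (by omega)]
      simp [monSpan]
    · intro q i hi
      simp only [Finset.range_zero, Finset.sum_empty, add_zero, ne_eq, ite_eq_right_iff,
        one_ne_zero, imp_false, not_not] at hi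
      omega
  | succ t ih =>
    obtain ⟨h1, h2⟩ := ih (by omega)
    have hnot : (⟨t, by omega⟩ : Fin (n + 1)) ∉ firstVars n t := by simp [firstVars]
    have := h1.insert_variable hnot h2
    rw [← firstVars_succ, card_firstVars (by omega)] at this
    simp only [Finset.sum_range_succ, ← add_assoc]
    exact this

/-- The exponents `z e` multiplying the monomials of degree `a₀ - e`, with `c = a₀ - a₁`. -/
noncomputable def lastExponent (N c e : ℕ) : Fin (N + 1 + 1) →₀ ℕ :=
  Finsupp.single ⟨N, by omega⟩ e + Finsupp.single ⟨N + 1, by omega⟩ (e - c)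

theorem degree_lastExponent (N c e : ℕ) : (lastExponent N c e).degree = e + (e - c) := by
  rw [lastExponent, map_add, Finsupp.degree_single, Finsupp.degree_single]

/-- The Betti numbers of the two fat points scheme. -/
def fatBetti (N a₀ a₁ q : ℕ) (j : ℤ) : ℕ :=
  (if q = 0 ∧ j = 0 then 1 else 0) +
    ∑ s ∈ Finset.range N, (s + 1).multichoose (a₀ - 1) * koszulBetti s a₀ q j +
    ∑ e ∈ Finset.Icc 1 a₀, N.multichoose (a₀ - e) *
      koszulBetti N (a₀ + (e - (a₀ - a₁))) q j

theorem hasBetti_chainSet (N a₀ a₁ : ℕ) (h₀ : 1 ≤ a₀) :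
    HasBetti (monSpan k (chainSet (firstVars (N + 1) N) a₀ (lastExponent N (a₀ - a₁)) a₀))
      (fatBetti N a₀ a₁) := by
  obtain ⟨a, rfl⟩ := Nat.exists_eq_add_of_le' h₀
  obtain ⟨h1, h2⟩ := hasBetti_power (k := k) (N + 1) a N (by omega)
  refine ((h1.chain (z := lastExponent N (a + 1 - a₁)) ?_ ?_ ?_ ?_ h2 (a + 1) le_rfl).1).congr rfl ?_
  · simp [lastExponent]
  · intro e s hs
    simp only [firstVars, Finset.mem_filter, Finset.mem_univ, true_and] at hs
    have h3 : (⟨N, by omega⟩ : Fin (N + 1 + 1)) ≠ s := by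
      rw [ne_eq, Fin.ext_iff, Fin.val_mk]
      omega
    have h4 : (⟨N + 1, by omega⟩ : Fin (N + 1 + 1)) ≠ s := by
      rw [ne_eq, Fin.ext_iff, Fin.val_mk]
      omega
    simp [lastExponent, h3, h4]
  · intro e
    unfold lastExponent
    gcongr <;> omega
  -- The degree grows by one per step while `e < a₀ - a₁`, and by two from then on.
  · intro e _
    rw [degree_lastExponent, degree_lastExponent]
    omega
  · intro q j
    unfold fatBetti
    congr 1
    refine Finset.sum_congr rfl fun e he => ?_
    rw [Finset.mem_Icc] at he
    rw [Finset.card_finsuppAntidiag_nat_eq_multichoose, card_firstVars (by omega),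
      degree_lastExponent]
    congr 2
    omega

/-- Powers of ideals generated by variables. -/
theorem mem_span_X_pow {σ : Type*} [DecidableEq σ] {S : Finset σ} {d : ℕ} {f : MvPolynomial σ k} :
    f ∈ Ideal.span ((X : σ → MvPolynomial σ k) '' S) ^ d ↔
      ∀ m ∈ f.support, d ≤ ∑ s ∈ S, m s := by
  classical
  constructor
  · induction d generalizing f with
    | zero => simp
    | succ d ih =>
      intro hf
      rw [pow_succ] at hf
      refine Submodule.mul_induction_on hf ?_ ?_
      · intro g hg h hh m hm
        obtain ⟨x, hx, y, hy, rfl⟩ := Finset.mem_add.1 (support_mul g h hm)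
        obtain ⟨i, hi, hi'⟩ := mem_ideal_span_X_image.1 hh y hy
        have h1 := ih hg x hx
        have h2 : 1 ≤ ∑ s ∈ S, y s :=
          (Nat.one_le_iff_ne_zero.2 hi').trans
            (Finset.single_le_sum (f := fun s => y s) (fun _ _ => Nat.zero_le _) hi)
        simp only [Finsupp.add_apply, Finset.sum_add_distrib]
        omega
      · intro g h hg hh m hm
        rcases Finset.mem_union.1 (support_add hm) with h' | h'
        exacts [hg m h', hh m h']
  · intro h
    have key : ∀ (d : ℕ), ∀ m ∈ S.finsuppAntidiag d, ∀ c : k,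
        monomial m c ∈ Ideal.span ((X : σ → MvPolynomial σ k) '' S) ^ d := by
      intro d m hm c
      rw [Finset.mem_finsuppAntidiag] at hm
      have h1 : (monomial m c : MvPolynomial σ k) = C c * ∏ s ∈ S, X s ^ m s := by
        rw [monomial_eq, Finsupp.prod_of_support_subset _ hm.2 _ (by simp)]
      have h2 : ∑ s ∈ S, m s = d := hm.1
      rw [h1, ← h2, ← Finset.prod_pow_eq_pow_sum]
      exact Ideal.mul_mem_left _ _ (Ideal.prod_mem_prod fun s hs =>
        Ideal.pow_mem_pow (Ideal.subset_span (Set.mem_image_of_mem X (Finset.mem_coe.2 hs))) _)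
    rw [f.as_sum]
    refine Ideal.sum_mem _ fun m hm => ?_
    obtain ⟨m', hm', hle⟩ := exists_le_mem_finsuppAntidiag d (h m hm)
    have : monomial m (coeff m f) = monomial (m - m') 1 * monomial m' (coeff m f) := by
      rw [monomial_mul, one_mul, tsub_add_cancel_of_le hle]
    rw [this]
    exact Ideal.mul_mem_left _ _ (key d m' hm' _)

/-- The ideal of two fat points at the last two coordinate points. -/
theorem monSpan_chainSet (N a₀ a₁ : ℕ) (ha : a₁ ≤ a₀) :
    monSpan k (chainSet (firstVars (N + 1) N) a₀ (lastExponent N (a₀ - a₁)) a₀) =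
      Ideal.span (X '' ({s | s ≠ ⟨N + 1, by omega⟩} : Set (Fin (N + 1 + 1)))) ^ a₀ ⊓
      Ideal.span (X '' ({s | s ≠ ⟨N, by omega⟩} : Set (Fin (N + 1 + 1)))) ^ a₁ := by
  set x₁ : Fin (N + 1 + 1) := ⟨N, by omega⟩ with hx₁
  set x₀ : Fin (N + 1 + 1) := ⟨N + 1, by omega⟩ with hx₀
  have hne : x₁ ≠ x₀ := by simp [hx₁, hx₀]
  have n₁ : x₁ ∉ firstVars (N + 1) N := by simp [firstVars, hx₁]
  have n₀ : x₀ ∉ firstVars (N + 1) N := by simp [firstVars, hx₀]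
  have e₀ : ({s | s ≠ x₀} : Set (Fin (N + 1 + 1))) = (insert x₁ (firstVars (N + 1) N) : Finset _) := by
    ext s
    simp [firstVars, Fin.ext_iff, hx₁, hx₀]
    omega
  have e₁ : ({s | s ≠ x₁} : Set (Fin (N + 1 + 1))) = (insert x₀ (firstVars (N + 1) N) : Finset _) := by
    ext s
    simp [firstVars, Fin.ext_iff, hx₁, hx₀]
    omega
  rw [e₀, e₁]
  ext f
  rw [Ideal.mem_inf, mem_span_X_pow, mem_span_X_pow, mem_monSpan, ← forall₂_and]
  refine forall₂_congr fun w _ => ?_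
  rw [Finset.sum_insert n₁, Finset.sum_insert n₀]
  constructor
  · rintro ⟨v, ⟨e, he, m, hm, rfl⟩, hle⟩
    have h1 : ∑ s ∈ firstVars (N + 1) N, m s = a₀ - e := (Finset.mem_finsuppAntidiag.1 hm).1
    have h2 : ∑ s ∈ firstVars (N + 1) N, m s ≤ ∑ s ∈ firstVars (N + 1) N, w s :=
      Finset.sum_le_sum fun s _ => le_trans (by simp) (hle s)
    have h3 : e ≤ w x₁ := le_trans (by simp [lastExponent, hx₁]) (hle x₁)
    have h4 : e - (a₀ - a₁) ≤ w x₀ := le_trans (by simp [lastExponent, hx₀]) (hle x₀)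
    omega
  · rintro ⟨h0, h1⟩
    -- The block containing a divisor of `w` is `e = a₀ - s`, truncated at `0`; the `S`-part of the
    -- divisor then has degree `a₀ - (a₀ - s) = min a₀ s`.
    set s := ∑ s ∈ firstVars (N + 1) N, w s with hs
    obtain ⟨m, hm, hle⟩ := exists_le_mem_finsuppAntidiag (S := firstVars (N + 1) N) (m := w)
      (a₀ - (a₀ - s)) (by omega)
    refine ⟨lastExponent N (a₀ - a₁) (a₀ - s) + m, ⟨a₀ - s, by omega, m, hm, rfl⟩, ?_⟩
    have hz : ∀ i ∉ firstVars (N + 1) N, m i = 0 := by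
      intro i hi
      by_contra h
      exact hi ((Finset.mem_finsuppAntidiag.1 hm).2 (Finsupp.mem_support_iff.2 h))
    intro i
    rw [Finsupp.add_apply]
    by_cases hi1 : i = x₁
    · subst hi1
      rw [hz _ n₁]
      simp only [lastExponent, Finsupp.add_apply, ← hx₁, ← hx₀, Finsupp.single_eq_same,
        Finsupp.single_apply, hne.symm, if_false]
      omega
    · by_cases hi0 : i = x₀
      · subst hi0
        rw [hz _ n₀]
        simp only [lastExponent, Finsupp.add_apply, ← hx₁, ← hx₀, Finsupp.single_eq_same,
          Finsupp.single_apply, hne, if_false]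
        omega
      · simp only [lastExponent, Finsupp.add_apply, ← hx₁, ← hx₀, Finsupp.single_apply,
          Ne.symm hi1, Ne.symm hi0, if_false, zero_add]
        exact hle i

end FinalIdeal

/-! ### Transport along graded ring automorphisms -/

section Transport

variable {k : Type*} [Field k] {σ : Type*} {ι κ : Type*}

/-- Conjugation of a linear map of free modules by an automorphism of the ring. -/
noncomputable def conjMap (ψ : MvPolynomial σ k ≃+* MvPolynomial σ k)
    (d : (ι → MvPolynomial σ k) →ₗ[MvPolynomial σ k] (κ → MvPolynomial σ k)) :
    (ι → MvPolynomial σ k) →ₗ[MvPolynomial σ k] (κ → MvPolynomial σ k) where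
  toFun f := fun c => ψ.symm (d (fun b => ψ (f b)) c)
  map_add' f g := by
    have : (fun b => ψ ((f + g) b)) = (fun b => ψ (f b)) + fun b => ψ (g b) := by
      funext b
      simp
    ext1 c
    rw [this, map_add, Pi.add_apply, Pi.add_apply, map_add]
  map_smul' r f := by
    have : (fun b => ψ ((r • f) b)) = ψ r • fun b => ψ (f b) := by
      funext b
      simp
    ext1 c
    rw [this, map_smul, Pi.smul_apply, smul_eq_mul, map_mul, RingEquiv.symm_apply_apply]
    rfl

theorem conjMap_apply (ψ : MvPolynomial σ k ≃+* MvPolynomial σ k)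
    (d : (ι → MvPolynomial σ k) →ₗ[MvPolynomial σ k] (κ → MvPolynomial σ k))
    (f : ι → MvPolynomial σ k) (c : κ) :
    conjMap ψ d f c = ψ.symm (d (fun b => ψ (f b)) c) := rfl

theorem conjMap_eq_iff (ψ : MvPolynomial σ k ≃+* MvPolynomial σ k)
    (d : (ι → MvPolynomial σ k) →ₗ[MvPolynomial σ k] (κ → MvPolynomial σ k))
    (f : ι → MvPolynomial σ k) (g : κ → MvPolynomial σ k) :
    conjMap ψ d f = g ↔ d (fun b => ψ (f b)) = fun b => ψ (g b) := by
  simp only [funext_iff, conjMap_apply, RingEquiv.symm_apply_eq]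

theorem exists_conjMap_eq_iff (ψ : MvPolynomial σ k ≃+* MvPolynomial σ k)
    (d : (ι → MvPolynomial σ k) →ₗ[MvPolynomial σ k] (κ → MvPolynomial σ k))
    (g : κ → MvPolynomial σ k) :
    (∃ f, conjMap ψ d f = g) ↔ ∃ f, d f = fun b => ψ (g b) := by
  simp only [conjMap_eq_iff]
  constructor
  · rintro ⟨f, hf⟩
    exact ⟨_, hf⟩
  · rintro ⟨f, hf⟩
    exact ⟨fun b => ψ.symm (f b), by simpa using hf⟩

theorem IsGraded.conjMap {ψ : MvPolynomial σ k ≃+* MvPolynomial σ k}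
    (hψ : ∀ f t, IsHomogeneousOfDegree f t → IsHomogeneousOfDegree (ψ f) t)
    (hψ' : ∀ f t, IsHomogeneousOfDegree f t → IsHomogeneousOfDegree (ψ.symm f) t)
    {deg : ι → ℤ} {deg' : κ → ℤ}
    {d : (ι → MvPolynomial σ k) →ₗ[MvPolynomial σ k] (κ → MvPolynomial σ k)}
    (hd : IsGraded deg deg' d) : IsGraded deg deg' (conjMap ψ d) :=
  fun t _ hf c => hψ' _ _ (hd t _ (fun b => hψ _ _ (hf b)) c)

/-- Graded automorphisms of the ring transport minimal graded free resolutions. -/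
theorem HasBetti.comap {J : Ideal (MvPolynomial σ k)} {β : ℕ → ℤ → ℕ} (hJ : HasBetti J β)
    {ψ : MvPolynomial σ k ≃+* MvPolynomial σ k}
    (hψ : ∀ f t, IsHomogeneousOfDegree f t → IsHomogeneousOfDegree (ψ f) t)
    (hψ' : ∀ f t, IsHomogeneousOfDegree f t → IsHomogeneousOfDegree (ψ.symm f) t)
    (hc : ∀ f, constantCoeff f = 0 → constantCoeff (ψ.symm f) = 0) :
    HasBetti (J.comap ψ) β := by
  obtain ⟨F, hF⟩ := hJ
  exact ⟨{
    ι := F.ι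
    fintype := F.fintype
    deg := F.deg
    d := fun q => FatPoints.conjMap ψ (F.d q)
    aug := FatPoints.conjMap ψ F.aug
    d_graded := fun q => (F.d_graded q).conjMap hψ hψ'
    aug_graded := F.aug_graded.conjMap hψ hψ'
    aug_surjective := fun g => (exists_conjMap_eq_iff ψ F.aug g).2 (F.aug_surjective _)
    exact_aug := fun f => by
      rw [exists_conjMap_eq_iff, ← F.exact_aug, Ideal.mem_comap, conjMap_apply]
      simp
    exact_d := fun q f => by
      rw [exists_conjMap_eq_iff, ← F.exact_d, conjMap_eq_iff]
      simp [funext_iff]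
    minimal := fun q f b => hc _ (F.minimal q _ b) }, hF⟩

end Transport

/-! ### Moving two points to coordinate points -/

section Coordinates

variable {k : Type*} [Field k] {n : ℕ}

/-- The linear substitution of variables with matrix `A`. -/
noncomputable def linSub {σ : Type*} [Fintype σ] (A : Matrix σ σ k) :
    MvPolynomial σ k →ₐ[k] MvPolynomial σ k :=
  aeval fun j => ∑ i, C (A i j) * X i

theorem linSub_X {σ : Type*} [Fintype σ] (A : Matrix σ σ k) (j : σ) :
    linSub A (X j) = ∑ i, C (A i j) * X i := by
  simp [linSub]

theorem linSub_comp {σ : Type*} [Fintype σ] (A B : Matrix σ σ k) :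
    (linSub A).comp (linSub B) = linSub (A * B) := by
  refine algHom_ext fun j => ?_
  rw [AlgHom.comp_apply, linSub_X, linSub_X, map_sum]
  simp only [map_mul, linSub_X, algHom_C, Finset.mul_sum, Matrix.mul_apply, map_sum, Finset.sum_mul]
  rw [Finset.sum_comm]
  refine Finset.sum_congr rfl fun l _ => Finset.sum_congr rfl fun i _ => ?_
  simp only [algebraMap_eq]
  ring

theorem linSub_one {σ : Type*} [Fintype σ] [DecidableEq σ] :
    linSub (1 : Matrix σ σ k) = AlgHom.id k _ := by
  refine algHom_ext fun j => ?_
  rw [linSub_X, AlgHom.id_apply, Finset.sum_eq_single j]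
  · simp
  · intro i _ hi
    simp [Matrix.one_apply_ne hi]
  · simp

/-- The substitution pulls polynomials back along a linear map sending the `i`-th coordinate vector
to row `i`; hence the points are prescribed as rows of `A`. -/
theorem eval_linSub {σ : Type*} [Fintype σ] [DecidableEq σ] (A : Matrix σ σ k) (i : σ)
    (f : MvPolynomial σ k) : eval (Pi.single i 1) (linSub A f) = eval (A i) f := by
  have : (aeval (Pi.single i 1) : MvPolynomial σ k →ₐ[k] k).comp (linSub A) = aeval (A i) := by
    refine algHom_ext fun j => ?_
    rw [AlgHom.comp_apply, linSub_X]
    simp [Pi.single_apply]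
  have h2 := DFunLike.congr_fun this f
  simpa [AlgHom.comp_apply, aeval_eq_eval] using h2

theorem IsHomogeneousOfDegree.linSub {σ : Type*} [Fintype σ] (A : Matrix σ σ k)
    {f : MvPolynomial σ k} {t : ℤ} (hf : IsHomogeneousOfDegree f t) :
    IsHomogeneousOfDegree (linSub A f) t := by
  by_cases ht : t < 0
  · rw [hf.eq_zero_of_neg ht, map_zero]
    exact IsHomogeneousOfDegree.zero t
  · obtain ⟨d, rfl⟩ := Int.eq_ofNat_of_zero_le (not_lt.1 ht)
    have := hf.isHomogeneous.aeval (n := 1) (fun j => ∑ i, C (A i j) * X i) (fun j =>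
      IsHomogeneous.sum _ _ _ fun i _ => by
        simpa using (isHomogeneous_C σ (A i j)).mul (isHomogeneous_X k i))
    rw [one_mul] at this
    exact this.isHomogeneousOfDegree

theorem constantCoeff_linSub {σ : Type*} [Fintype σ] (A : Matrix σ σ k) (f : MvPolynomial σ k) :
    constantCoeff (linSub A f) = constantCoeff f := by
  have : (constantCoeff : MvPolynomial σ k →+* k).comp (linSub A).toRingHom = constantCoeff := by
    refine ringHom_ext (fun r => ?_) fun j => ?_
    · simp
    · simp [linSub_X]
  exact DFunLike.congr_fun this f

/-- The automorphism of the polynomial ring given by an invertible matrix. -/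
noncomputable def linSubEquiv {σ : Type*} [Fintype σ] [DecidableEq σ] (A : (Matrix σ σ k)ˣ) :
    MvPolynomial σ k ≃ₐ[k] MvPolynomial σ k :=
  AlgEquiv.ofAlgHom (linSub A.1) (linSub A⁻¹.1)
    (by rw [linSub_comp, Units.mul_inv, linSub_one])
    (by rw [linSub_comp, Units.inv_mul, linSub_one])

/-- A homogeneous polynomial vanishing at a coordinate point lies in the ideal of the other
variables. -/
theorem mem_span_X_of_eval_eq_zero {σ : Type*} [Fintype σ] [DecidableEq σ] {f : MvPolynomial σ k}
    {d : ℕ} {i : σ} (hf : f.IsHomogeneous d) (h : eval (Pi.single i 1) f = 0) :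
    f ∈ Ideal.span ((X : σ → MvPolynomial σ k) '' {s | s ≠ i}) := by
  rw [mem_ideal_span_X_image]
  intro m hm
  by_contra! hm'
  -- The only monomial of degree `d` outside the ideal is the pure power of `X i`, and its
  -- coefficient is the value of `f` at the coordinate point.
  have hmi : m = Finsupp.single i d := by
    have h1 : m = Finsupp.single i (m i) := by
      ext s
      by_cases hs : s = i
      · subst hs; simp
      · rw [hm' s hs, Finsupp.single_eq_of_ne hs]
    have h2 := hf.isHomogeneousOfDegree m hm
    rw [h1, Finsupp.degree_single] at h2
    rw [h1]
    congr 1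
    exact_mod_cast h2
  rw [eval_eq, Finset.sum_eq_single m] at h
  · rw [hmi] at h hm
    rw [mem_support_iff] at hm
    refine hm ?_
    rw [Finset.prod_eq_one, mul_one] at h
    · exact h
    · intro s hs
      have := Finsupp.support_single_subset hs
      rw [Finset.mem_singleton] at this
      subst this
      simp
  · intro m' hm'' hne
    obtain ⟨s, hs, hsi⟩ : ∃ s, m' s ≠ 0 ∧ s ≠ i := by
      by_contra! hcon
      apply hne
      have h1 : m' = Finsupp.single i (m' i) := by
        ext s
        by_cases hs : s = i
        · subst hs; simp
        · rw [Finsupp.single_eq_of_ne hs]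
          by_contra h0
          exact hs (hcon s h0)
      have h2 := hf.isHomogeneousOfDegree m' hm''
      rw [h1, Finsupp.degree_single] at h2
      rw [h1, hmi]
      congr 1
      exact_mod_cast h2
    rw [Finset.prod_eq_zero (Finsupp.mem_support_iff.2 hs), mul_zero]
    rw [Pi.single_eq_of_ne hsi, zero_pow hs]
  · intro hm''
    exact absurd hm hm''

theorem pointIdeal_eq_comap (P : Projectivization k (Fin (n + 1) → k))
    (A : (Matrix (Fin (n + 1)) (Fin (n + 1)) k)ˣ) (i : Fin (n + 1)) (hA : A.1 i = P.rep) :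
    pointIdeal P = (Ideal.span ((X : Fin (n + 1) → MvPolynomial (Fin (n + 1)) k) ''
      {s | s ≠ i})).comap (linSubEquiv A).toRingEquiv := by
  refine le_antisymm (Ideal.span_le.2 ?_) ?_
  · rintro f ⟨⟨d, hd⟩, hf⟩
    refine mem_span_X_of_eval_eq_zero (d := d) ?_ (i := i) ?_
    · exact (hd.isHomogeneousOfDegree.linSub A.1).isHomogeneous
    · rw [← hf, ← hA]
      exact eval_linSub A.1 i f
  -- The pulled-back ideal is generated by the preimages of the variables other than `X i`, which
  -- are linear forms vanishing at `P`.
  · rw [← Ideal.map_symm, Ideal.map_span, Ideal.span_le]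
    rintro _ ⟨_, ⟨s, hs, rfl⟩, rfl⟩
    refine Ideal.subset_span ⟨⟨1, ?_⟩, ?_⟩
    · exact ((isHomogeneous_X k s).isHomogeneousOfDegree.linSub A⁻¹.1).isHomogeneous
    · rw [← hA, ← eval_linSub]
      have : linSub A.1 ((linSubEquiv A).symm (X s)) = X s := (linSubEquiv A).apply_symm_apply _
      refine (congrArg _ this).trans ?_
      rw [eval_X, Pi.single_eq_of_ne hs]

/-- Representatives of distinct points are linearly independent, so they extend to a basis, whose
vectors are the rows after reindexing. -/
theorem exists_matrix_rows (P₀ P₁ : Projectivization k (Fin (n + 1) → k)) (hP : P₀ ≠ P₁)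
    (x₀ x₁ : Fin (n + 1)) (hx : x₀ ≠ x₁) :
    ∃ A : (Matrix (Fin (n + 1)) (Fin (n + 1)) k)ˣ, A.1 x₀ = P₀.rep ∧ A.1 x₁ = P₁.rep := by
  classical
  have hli := Projectivization.independent_iff.1 ((Projectivization.independent_pair_iff_ne P₀ P₁).2 hP)
  let b := Module.Basis.sumExtend hli
  have hfin := Module.Finite.finite_basis b
  have := Fintype.ofFinite (Fin 2 ⊕ Module.Basis.sumExtendIndex hli)
  have hcard : Fintype.card (Fin 2 ⊕ Module.Basis.sumExtendIndex hli) = Fintype.card (Fin (n + 1)) := by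
    rw [← Module.finrank_eq_card_basis b]
    simp
  let e := Fintype.equivOfCardEq hcard
  let e₁ := e.trans (Equiv.swap (e (Sum.inl 0)) x₀)
  have h0 : e₁ (Sum.inl 0) = x₀ := by simp [e₁]
  let e₂ := e₁.trans (Equiv.swap (e₁ (Sum.inl 1)) x₁)
  -- The second transposition moves neither endpoint of the first assignment, as `x₀` differs from
  -- both indices it exchanges.
  have h0' : e₂ (Sum.inl 0) = x₀ := by
    have : x₀ ≠ e₁ (Sum.inl 1) := by
      rw [← h0]
      exact fun h => by simpa using e₁.injective h
    simp only [e₂, Equiv.trans_apply, h0]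
    exact Equiv.swap_apply_of_ne_of_ne this hx
  have h1' : e₂ (Sum.inl 1) = x₁ := by simp [e₂]
  let b' := b.reindex e₂
  have hunit : IsUnit (Matrix.of fun i => b' i) :=
    Matrix.linearIndependent_rows_iff_isUnit.1 b'.linearIndependent
  have hb : ∀ i, b (Sum.inl i) = (Projectivization.rep ∘ ![P₀, P₁]) i := fun i => by
    simp only [b, Module.Basis.sumExtend, Module.Basis.reindex_apply, Module.Basis.extend_apply_self]
    rfl
  refine ⟨hunit.unit, ?_, ?_⟩
  · change b' x₀ = _
    rw [← h0', Module.Basis.reindex_apply, Equiv.symm_apply_apply, hb]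
    rfl
  · change b' x₁ = _
    rw [← h1', Module.Basis.reindex_apply, Equiv.symm_apply_apply, hb]
    rfl

end Coordinates

/-! ### Betti numbers of two fat points and binomial identities -/

section TwoFatPoints

variable {k : Type*} [Field k]

theorem hasBetti_twoFatPointsIdeal {N : ℕ} (P₀ P₁ : Projectivization k (Fin (N + 1 + 1) → k))
    (hP : P₀ ≠ P₁) (a₀ a₁ : ℕ) (h₀ : 1 ≤ a₀) (ha : a₁ ≤ a₀) :
    HasBetti (twoFatPointsIdeal P₀ P₁ a₀ a₁) (fatBetti N a₀ a₁) := by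
  obtain ⟨A, hA₀, hA₁⟩ := exists_matrix_rows P₀ P₁ hP ⟨N + 1, by omega⟩ ⟨N, by omega⟩ (by simp)
  -- For an automorphism, pulling back is pushing forward along the inverse, which commutes with
  -- powers.
  have hpow : ∀ (J : Ideal (MvPolynomial (Fin (N + 1 + 1)) k)) (a : ℕ),
      (J.comap (linSubEquiv A).toRingEquiv) ^ a = (J ^ a).comap (linSubEquiv A).toRingEquiv := by
    intro J a
    rw [← Ideal.map_symm, ← Ideal.map_symm, Ideal.map_pow]
  refine ((hasBetti_chainSet N a₀ a₁ h₀).comap (ψ := (linSubEquiv A).toRingEquiv)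
    (fun f t hf => hf.linSub A.1) (fun f t hf => hf.linSub A⁻¹.1)
    (fun f hf => (constantCoeff_linSub A⁻¹.1 f).trans hf)).congr ?_ fun _ _ => rfl
  rw [monSpan_chainSet N a₀ a₁ ha, twoFatPointsIdeal, pointIdeal_eq_comap P₀ A _ hA₀,
    pointIdeal_eq_comap P₁ A _ hA₁, hpow, hpow, Ideal.comap_inf]

/-- By Pascal's rule the right side grows by `(a + N).choose (a + p) * (a + p).choose p`, which is
the new summand by the subset-of-a-subset identity. It evaluates the contribution of block `0`. -/
theorem sum_range_choose_mul_choose (N a p : ℕ) :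
    ∑ s ∈ Finset.range N, (s + a).choose a * s.choose p =
      (a + N).choose (a + p + 1) * (a + p).choose p := by
  induction N with
  | zero => simp [Nat.choose_eq_zero_of_lt (show a < a + p + 1 by omega)]
  | succ N ih =>
    rw [Finset.sum_range_succ, ih, ← add_assoc a N 1, Nat.choose_succ_succ (a + N) (a + p), add_mul,
      add_comm]
    congr 1
    rcases le_or_gt p N with hp | hp
    · have := Nat.choose_mul (n := N + a) (k := a + p) (s := a) (by omega)
      rw [Nat.add_sub_cancel, Nat.add_sub_cancel_left] at this
      rw [← this, add_comm N a, Nat.choose_symm_add]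
    · rw [Nat.choose_eq_zero_of_lt hp, Nat.choose_eq_zero_of_lt (show a + N < a + p by omega)]
      simp

theorem fatBetti_zero (N a₀ a₁ : ℕ) (j : ℤ) : fatBetti N a₀ a₁ 0 j = if j = 0 then 1 else 0 := by
  simp [fatBetti, koszulBetti]

theorem koszulBetti_of_eq {c D q : ℕ} {j : ℤ} (hq : 1 ≤ q) (hj : j = (q : ℤ) - 1 + D) :
    koszulBetti c D q j = c.choose (q - 1) := if_pos ⟨hq, hj⟩

theorem koszulBetti_of_ne {c D q : ℕ} {j : ℤ} (hj : j ≠ (q : ℤ) - 1 + D) :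
    koszulBetti c D q j = 0 := if_neg fun h => hj h.2

theorem fatBetti_initial (N a₀ a₁ q : ℕ) (h₀ : 1 ≤ a₀) (hq : 1 ≤ q) :
    fatBetti N a₀ a₁ q ((q : ℤ) + a₀ - 1) =
      (a₀ + (N + 1) - 2).choose (a₀ + q - 1) * (a₀ + q - 2).choose (q - 1) +
        ∑ i ∈ Finset.Icc 1 (a₀ - a₁),
          (a₀ - i + (N + 1) - 2).choose (a₀ - i) * (N + 1 - 1).choose (q - 1) := by
  unfold fatBetti
  rw [if_neg (by omega), zero_add]
  congr 1
  · obtain ⟨a, rfl⟩ := Nat.exists_eq_add_of_le' h₀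
    obtain ⟨p, rfl⟩ := Nat.exists_eq_add_of_le' hq
    have := sum_range_choose_mul_choose N a p
    rw [show a + 1 + (N + 1) - 2 = a + N by omega, show a + 1 + (p + 1) - 1 = a + p + 1 by omega,
      show a + 1 + (p + 1) - 2 = a + p by omega, show p + 1 - 1 = p by omega, ← this]
    refine Finset.sum_congr rfl fun s _ => ?_
    rw [koszulBetti_of_eq (by omega) (by push_cast; ring), Nat.multichoose_eq]
    congr 2
    omega
  -- Blocks with `e > a₀ - a₁` have generators of degree above `a₀` and do not meet this strand.
  · have hsub : Finset.Icc 1 (a₀ - a₁) ⊆ Finset.Icc 1 a₀ := Finset.Icc_subset_Icc_right (by omega)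
    rw [← Finset.sum_subset hsub]
    · refine Finset.sum_congr rfl fun i hi => ?_
      rw [Finset.mem_Icc] at hi
      rw [koszulBetti_of_eq hq (by omega), Nat.multichoose_eq, Nat.add_sub_cancel]
      congr 2
      omega
    · intro e he he'
      rw [Finset.mem_Icc] at he he'
      rw [koszulBetti_of_ne (by omega), mul_zero]

theorem fatBetti_higher (N a₀ a₁ q i : ℕ) (ha : a₁ ≤ a₀) (hq : 1 ≤ q) (hi : i < a₁) :
    fatBetti N a₀ a₁ q ((q : ℤ) + a₀ + i) =
      (a₁ - i + (N + 1) - 3).choose (a₁ - i - 1) * (N + 1 - 1).choose (q - 1) := by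
  unfold fatBetti
  -- Only the block with generator degree `a₀ + i + 1`, namely `e = a₀ - a₁ + 1 + i`, meets this
  -- strand.
  rw [if_neg (by omega), zero_add, Finset.sum_eq_zero, zero_add,
    Finset.sum_eq_single (a₀ - a₁ + 1 + i)]
  · rw [koszulBetti_of_eq hq (by omega), Nat.multichoose_eq, Nat.add_sub_cancel]
    congr 2 <;> omega
  · intro e he hne
    rw [Finset.mem_Icc] at he
    rw [koszulBetti_of_ne (by omega), mul_zero]
  · intro h
    exact absurd (Finset.mem_Icc.2 ⟨by omega, by omega⟩) h
  · intro s _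
    rw [koszulBetti_of_ne (by omega), mul_zero]

theorem fatBetti_eq_zero (N a₀ a₁ q : ℕ) (ha : a₁ ≤ a₀) (hq : 1 ≤ q) (j : ℤ)
    (hj : j ≠ (q : ℤ) + a₀ - 1) (hj' : ∀ i : ℕ, i < a₁ → j ≠ (q : ℤ) + a₀ + i) :
    fatBetti N a₀ a₁ q j = 0 := by
  unfold fatBetti
  rw [if_neg (by omega), zero_add, Finset.sum_eq_zero, zero_add, Finset.sum_eq_zero]
  · intro e he
    rw [Finset.mem_Icc] at he
    rw [koszulBetti_of_ne, mul_zero]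
    rcases le_or_gt e (a₀ - a₁) with h | h
    · omega
    · have := hj' (e - (a₀ - a₁) - 1) (by omega)
      omega
  · intro s _
    rw [koszulBetti_of_ne (by omega), mul_zero]

end TwoFatPoints

end FatPoints

theorem theorem2p7 {k : Type*} [Field k] (n : ℕ) (hn : 2 ≤ n)
    (P₀ P₁ : Projectivization k (Fin (n + 1) → k)) (hP : P₀ ≠ P₁)
    (a₀ a₁ : ℕ) (ha₁ : 1 ≤ a₁) (ha : a₁ ≤ a₀) :
    Nonempty (FatPoints.MinimalGradedFreeResolution
      (FatPoints.twoFatPointsIdeal P₀ P₁ a₀ a₁)) ∧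
    ∀ F : FatPoints.MinimalGradedFreeResolution (FatPoints.twoFatPointsIdeal P₀ P₁ a₀ a₁),
      (∀ q : ℕ, 1 ≤ q →
        F.betti q ((q : ℤ) + a₀ - 1) =
          (a₀ + n - 2).choose (a₀ + q - 1) * (a₀ + q - 2).choose (q - 1) +
            ∑ i ∈ Finset.Icc 1 (a₀ - a₁),
              (a₀ - i + n - 2).choose (a₀ - i) * (n - 1).choose (q - 1)) ∧
      (∀ q : ℕ, 1 ≤ q → ∀ i : ℕ, i < a₁ →
        F.betti q ((q : ℤ) + a₀ + i) =
          (a₁ - i + n - 3).choose (a₁ - i - 1) * (n - 1).choose (q - 1)) ∧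
      F.betti 0 0 = 1 ∧
      (∀ j : ℤ, j ≠ 0 → F.betti 0 j = 0) ∧
      (∀ q : ℕ, 1 ≤ q → ∀ j : ℤ, j ≠ (q : ℤ) + a₀ - 1 →
        (∀ i : ℕ, i < a₁ → j ≠ (q : ℤ) + a₀ + i) → F.betti q j = 0) := by
  -- `N = n - 1` counts the coordinates that vanish at both points after the change of variables.
  obtain ⟨N, rfl⟩ := Nat.exists_eq_add_of_le' (show 1 ≤ n by omega)
  obtain ⟨K, hK⟩ := FatPoints.hasBetti_twoFatPointsIdeal P₀ P₁ hP a₀ a₁ (by omega) ha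
  obtain ⟨G, hG⟩ := K.exists_minimalGradedFreeResolution
  refine ⟨⟨G⟩, fun F => ?_⟩
  have hF : ∀ q j, F.betti q j = FatPoints.fatBetti N a₀ a₁ q j := fun q j =>
    (F.betti_unique (fun f hf t => K.intComponent_mem hf t) G q j).trans
      ((hG q j).trans (hK q j))
  refine ⟨fun q hq => ?_, fun q hq i hi => ?_, ?_, fun j hj => ?_, fun q hq j hj hj' => ?_⟩
  · rw [hF, FatPoints.fatBetti_initial N a₀ a₁ q (by omega) hq]
  · rw [hF, FatPoints.fatBetti_higher N a₀ a₁ q i ha hq hi]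
  · rw [hF, FatPoints.fatBetti_zero, if_pos rfl]
  · rw [hF, FatPoints.fatBetti_zero, if_neg hj]
  · rw [hF, FatPoints.fatBetti_eq_zero N a₀ a₁ q ha hq j hj hj']
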